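/- Let $\mathbf S$ be a relational schema, $\Sigma$ a finite set of functional dependencies (FDs) $R : X \to Y$ over $\mathbf S$ that has a left-hand-side chain up to equivalence, that is, some finite set $\Sigma'$ of FDs satisfied by the same databases as $\Sigma$ has the property that $X_1 \subseteq X_2$ or $X_2 \subseteq X_1$ for any two of its FDs $R : X_1 \to Y_1$ and $R : X_2 \to Y_2$ over the same relation name. Let $Q$ be a Boolean conjunctive query (with self-joins and constants allowed). A database is a finite set of facts over $\mathbf S$; a repair of $D$ w.r.t. $\Sigma$ is a $\subseteq$-maximal subset of $D$ that is consistent with $\Sigma$; $\|D\|$ is the size of the encoding of $D$. Let $\mathsf{hom}_{D,\Sigma}(Q)$ be the set of all $h(Q)$ where $h$ is a homomorphism from $Q$ to $D$ with $h(Q) \models \Sigma$. For a set $H$ of facts, read as a Boolean conjunctive query without variables, let $\mathsf{rep}_{\Sigma,H}(D)$ be the set of repairs of $D$ w.r.t. $\Sigma$ that entail $H$ (equivalently, that contain $H$). With $\Sigma$ and $Q$ fixed, there are algorithms that do the following on all inputs $D$ and $H \in \mathsf{hom}_{D,\Sigma}(Q)$: 1. compute $|\mathsf{rep}_{\Sigma,H}(D)|$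 deterministically in time polynomial in $\|D\|$; 2. output a random element of $\mathsf{rep}_{\Sigma,H}(D)$ (which is non-empty) that is exactly uniformly distributed, in worst-case time polynomial in $\|D\|$, where a randomized algorithm may draw uniformly from $\{0,\dots,n-1\}$ for a computed integer $n \ge 1$ given in binary, at a cost of at least the bit length of $n$; 3. given in addition a database $D'$, decide deterministically whether $D' \in \mathsf{rep}_{\Sigma,H}(D)$, in time polynomial in $\|D\| + \|D'\|$, and in time polynomial in $\|D\|$ when $D' \subseteq D$. -/

import Mathlib

/-! ## Relational databases, functional dependencies, repairs -/

/-- A relational schema: relation names `0, …, numRel - 1`, each with an arity. The attributes of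
the relation name `R` are the elements of `Fin (arity R)`. -/
structure Schema where
  numRel : ℕ
  arity : Fin numRel → ℕ

/-- A fact `R(c₁, …, cₙ)`. The countably infinite set of constants is `ℕ`. -/
abbrev DBFact (S : Schema) : Type := (R : Fin S.numRel) × (Fin (S.arity R) → ℕ)

/-- A database over `S` is a finite set of facts over `S`. -/
abbrev DB (S : Schema) : Type := Finset (DBFact S)

/-- A functional dependency `R : X → Y`, with `X` and `Y` sets of attributes of `R`. -/
structure FD (S : Schema) where
  rel : Fin S.numRel
  lhs : Finset (Fin (S.arity rel))
  rhs : Finset (Fin (S.arity rel))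

/-- `D ⊨ φ`: any two `R`-facts of `D` that agree on `X` agree on `Y`. -/
def FD.Holds {S : Schema} (φ : FD S) (D : DB S) : Prop :=
  ∀ a b : Fin (S.arity φ.rel) → ℕ,
    (⟨φ.rel, a⟩ : DBFact S) ∈ D → (⟨φ.rel, b⟩ : DBFact S) ∈ D →
      (∀ A ∈ φ.lhs, a A = b A) → ∀ A ∈ φ.rhs, a A = b A

/-- `D ⊨ Σ`: the database `D` is consistent with respect to `Σ`. -/
def Consistent {S : Schema} (Sig : Finset (FD S)) (D : DB S) : Prop :=
  ∀ φ ∈ Sig, φ.Holds D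

/-- `Σ` and `Σ'` are equivalent: they are satisfied by the same databases. -/
def FDEquiv {S : Schema} (Sig Sig' : Finset (FD S)) : Prop :=
  ∀ D : DB S, Consistent Sig D ↔ Consistent Sig' D

/-- `Σ` has an LHS chain: for any two FDs `R : X₁ → Y₁` and `R : X₂ → Y₂` of `Σ` over the same
relation name, `X₁ ⊆ X₂` or `X₂ ⊆ X₁`. -/
def HasLHSChain {S : Schema} (Sig : Finset (FD S)) : Prop :=
  ∀ (R : Fin S.numRel) (X₁ Y₁ X₂ Y₂ : Finset (Fin (S.arity R))),
    (⟨R, X₁, Y₁⟩ : FD S) ∈ Sig → (⟨R, X₂, Y₂⟩ : FD S) ∈ Sig → X₁ ⊆ X₂ ∨ X₂ ⊆ X₁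

/-- `Σ` has an LHS chain up to equivalence. -/
def HasLHSChainUpToEquiv {S : Schema} (Sig : Finset (FD S)) : Prop :=
  ∃ Sig' : Finset (FD S), FDEquiv Sig Sig' ∧ HasLHSChain Sig'

open Classical in
/-- The set of repairs of `D` with respect to `Σ`: the maximal consistent subsets of `D`. -/
noncomputable def repairs {S : Schema} (Sig : Finset (FD S)) (D : DB S) : Finset (DB S) :=
  D.powerset.filter fun E => Maximal (fun E' : DB S => E' ⊆ D ∧ Consistent Sig E') E

/-! ## Conjunctive queries -/

/-- A term of a query: a variable or a constant. -/
inductive Term where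
  | var (x : ℕ)
  | const (c : ℕ)
  deriving DecidableEq

/-- An atom `R(u₁, …, uₙ)`. -/
abbrev Atom (S : Schema) : Type := (R : Fin S.numRel) × (Fin (S.arity R) → Term)

/-- A Boolean conjunctive query, as the set of its atoms; self-joins are allowed. -/
abbrev CQ (S : Schema) : Type := Finset (Atom S)

/-- The value of a term under an assignment of the variables; constants are kept. -/
def Term.apply (h : ℕ → ℕ) : Term → ℕ
  | .var x => h x
  | .const c => c

/-- The fact `R(h(u₁), …, h(uₙ))`. -/
def Atom.apply {S : Schema} (h : ℕ → ℕ) (α : Atom S) : DBFact S :=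
  ⟨α.1, fun i => (α.2 i).apply h⟩

/-- The set of facts `h(Q)`. -/
def CQ.image {S : Schema} (Q : CQ S) (h : ℕ → ℕ) : DB S := Finset.image (Atom.apply h) Q

/-- `h` is a homomorphism from `Q` to `D`. -/
def CQ.IsHom {S : Schema} (Q : CQ S) (D : DB S) (h : ℕ → ℕ) : Prop := Q.image h ⊆ D

/-- `D ⊨ Q`. -/
def CQ.EntailedBy {S : Schema} (Q : CQ S) (D : DB S) : Prop := ∃ h, Q.IsHom D h

/-- A finite set of facts, read as a Boolean conjunctive query without variables. -/
def CQ.ofFacts {S : Schema} (H : DB S) : CQ S :=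
  Finset.image (fun f : DBFact S => (⟨f.1, fun i => Term.const (f.2 i)⟩ : Atom S)) H

/-- The consistent homomorphic images of `Q` in `D`: all `h(Q)` for `h` a homomorphism from `Q`
to `D` with `h(Q) ⊨ Σ`. -/
def homImages {S : Schema} (Sig : Finset (FD S)) (Q : CQ S) (D : DB S) : Set (DB S) :=
  {H | ∃ h, Q.IsHom D h ∧ Consistent Sig (Q.image h) ∧ H = Q.image h}

open Classical in
/-- The set of repairs of `D` with respect to `Σ` that entail `Q`. -/
noncomputable def repairsEntailing {S : Schema} (Sig : Finset (FD S)) (D : DB S) (Q : CQ S) :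
    Finset (DB S) :=
  (repairs Sig D).filter fun E => Q.EntailedBy E

/-! ## The machine model

Programs of a small Turing-complete while-language whose values are binary trees with natural
numbers (in binary) at the leaves. Every executed instruction is charged the size of the whole
value it works on (logarithmic cost), so the running time agrees with that of a multi-tape Turing
machine up to a polynomial. The only source of randomness is the instruction `draw`, a uniform draw
from `{0, …, n - 1}` for a computed `n ≥ 1`, at a cost of at least the bit length of `n`. -/

/-- The values that programs work on. -/
inductive Val where
  | num (n : ℕ)
  | pair (a b : Val)

/-- The size of a value, with numbers measured by their length in binary. -/
def Val.size : Val → ℕ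
  | .num n => Nat.size n + 1
  | .pair a b => a.size + b.size + 1

/-- The basic deterministic instructions. -/
inductive Op where
  | id
  | const (c : Val)
  | fst
  | snd
  | isPair
  | add
  | sub
  | mul

/-- The effect of a basic instruction; `num 0` is returned on arguments of a wrong shape. -/
def Op.apply : Op → Val → Val
  | .id, v => v
  | .const c, _ => c
  | .fst, .pair a _ => a
  | .snd, .pair _ b => b
  | .isPair, .pair _ _ => .num 1
  | .add, .pair (.num a) (.num b) => .num (a + b)
  | .sub, .pair (.num a) (.num b) => .num (a - b)
  | .mul, .pair (.num a) (.num b) => .num (a * b)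
  | _, _ => .num 0

/-- The distribution of the outcome of `draw`: on the number `n ≥ 1` it is uniform on
`{0, …, n - 1}`; on other values the outcome is `num 0`. -/
noncomputable def Val.drawDist : Val → PMF Val
  | .num (n + 1) => (PMF.uniformOfFintype (Fin (n + 1))).map fun k => Val.num k
  | _ => PMF.pure (.num 0)

/-- Programs. `pair p q` runs `p` and `q` on the same value and pairs the results; `seq p q` runs
`p` and then `q` on its result; `cond b p q` runs `b` and then, on the original value, `q` if the
result was `num 0` and `p` otherwise; `loop b p` repeats `p` as long as the result of `b` is not
`num 0`. -/
inductive Prog where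
  | op (o : Op)
  | draw
  | pair (p q : Prog)
  | seq (p q : Prog)
  | cond (b p q : Prog)
  | loop (b p : Prog)

/-- Deterministic programs: those without the instruction `draw`. -/
def Prog.Deterministic : Prog → Prop
  | .op _ => True
  | .draw => False
  | .pair p q => p.Deterministic ∧ q.Deterministic
  | .seq p q => p.Deterministic ∧ q.Deterministic
  | .cond b p q => b.Deterministic ∧ p.Deterministic ∧ q.Deterministic
  | .loop b p => b.Deterministic ∧ p.Deterministic

/-- `p.Run v μ t`: on input `v`, the program `p` halts after at most `t` time units whatever the
outcomes of its random draws, and the distribution of its output is `μ`. -/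
inductive Prog.Run : Prog → Val → PMF Val → ℕ → Prop
  | op (o : Op) (v : Val) : Run (.op o) v (PMF.pure (o.apply v)) v.size
  | draw (v : Val) : Run .draw v v.drawDist v.size
  | pair {p q : Prog} {v : Val} {μ ν : PMF Val} {s t : ℕ} :
      Run p v μ s → Run q v ν t →
      Run (.pair p q) v (μ.bind fun a => ν.bind fun b => PMF.pure (.pair a b)) (v.size + s + t)
  | seq {p q : Prog} {v : Val} {μ : PMF Val} {ν : Val → PMF Val} {s t : ℕ} :
      Run p v μ s → (∀ w ∈ μ.support, Run q w (ν w) t) →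
      Run (.seq p q) v (μ.bind ν) (v.size + s + t)
  | cond {b p q : Prog} {v : Val} {μ : PMF Val} {ν : Val → PMF Val} {s t : ℕ} :
      Run b v μ s →
      (∀ w ∈ μ.support, w ≠ .num 0 → Run p v (ν w) t) →
      (∀ w ∈ μ.support, w = .num 0 → Run q v (ν w) t) →
      Run (.cond b p q) v (μ.bind ν) (v.size + s + t)
  | loop {b p : Prog} {v : Val} {μ : PMF Val} {t : ℕ} :
      Run (.cond b (.seq p (.loop b p)) (.op .id)) v μ t → Run (.loop b p) v μ t
  | mono {p : Prog} {v : Val} {μ : PMF Val} {s t : ℕ} : Run p v μ s → s ≤ t → Run p v μ t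

/-! ## Databases as inputs and outputs of programs -/

/-- A list as a value: `[a₁, …, aₙ]` is `(a₁, (a₂, … (aₙ, 0)))`. -/
def encodeList {α : Type} (e : α → Val) : List α → Val
  | [] => .num 0
  | a :: l => .pair (e a) (encodeList e l)

/-- A fact as a value: its relation name, followed by the list of its constants. -/
def encodeFact {S : Schema} (f : DBFact S) : Val :=
  .pair (.num (f.1 : ℕ)) (encodeList Val.num (List.ofFn f.2))

/-- A list of facts as a value. -/
def encodeFacts {S : Schema} (l : List (DBFact S)) : Val := encodeList encodeFact l

/-- The list `l` enumerates the database `D`, in some order and without repetitions. -/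
def Enumerates {S : Schema} (l : List (DBFact S)) (D : DB S) : Prop :=
  l.Nodup ∧ l.toFinset = D

/-- `‖D‖`: the size of the encoding of `D`, which does not depend on the order of the facts. -/
def DB.norm {S : Schema} (D : DB S) : ℕ := (∑ f ∈ D, ((encodeFact f).size + 1)) + 1

theorem Enumerates.size_encodeFacts {S : Schema} {l : List (DBFact S)} {D : DB S}
    (h : Enumerates l D) : (encodeFacts l).size = DB.norm D := by
  obtain ⟨h₁, rfl⟩ := h
  unfold DB.norm
  rw [List.sum_toFinset _ h₁]
  clear h₁
  induction l with
  | nil => simp [encodeFacts, encodeList, Val.size]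
  | cons a l ih =>
    simp only [encodeFacts, encodeList, Val.size, List.map_cons, List.sum_cons] at ih ⊢
    omega

/-! ## Polynomial-time functions on encoded values -/

/-! Functional dependencies constrain pairs of facts, so the repairs of D are the maximal
independent sets of a conflict graph on D. Those containing a consistent H ⊆ D are the maximal
independent sets of the subgraph on the facts that conflict with no fact of H
(`mem_repairsEntailing_iff`).

List the dependencies X → Y of a chain by increasing left-hand side. Facts that disagree on the
first X are not in conflict, so the graph is a disjoint union over the classes of agreement on X.
Inside such a class, facts that disagree on Y are always in conflict, so there the graph is a join
over the classes of agreement on Y, and within each of these only the remaining dependencies matter.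
A maximal independent set of a disjoint union is a choice of one in every part
(`isMaxIndep_prod_iff`); in a join of nonempty parts it is one of a single part
(`isMaxIndep_sum_iff`). Hence the count is an alternation of products and sums, nested to a depth
fixed by Σ.

The same recursion gives a bijection between an initial segment of ℕ and the maximal independent
sets (`levelUnrank_unranks`). One uniform draw below the count, followed by unranking, is then
exactly uniform in worst-case polynomial time (`Unranks.map_uniform`, `Polytime.exists_run_draw`).
The unranking function takes a multiplier m and hands back a number below m for the next factor.
This mixed-radix scheme needs only addition, multiplication, subtraction and comparison, so no
division has to be programmed. Membership is tested directly on pairs of facts.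

Running times follow from closure properties of `Polytime`. The central one is recursion over a list
whose accumulator grows only additively (`Polytime.para`). -/

theorem Polynomial.eval_mono_nat (p : Polynomial ℕ) {m n : ℕ} (h : m ≤ n) :
    p.eval m ≤ p.eval n := by
  simp only [Polynomial.eval_eq_sum, Polynomial.sum]
  gcongr

/-- Types whose elements are represented by values. -/
class HasVal (α : Type) where
  enc : α → Val

open HasVal (enc)

instance : HasVal ℕ := ⟨Val.num⟩

instance : HasVal Bool := ⟨fun b => Val.num (if b then 1 else 0)⟩

instance {α β : Type} [HasVal α] [HasVal β] : HasVal (α × β) := ⟨fun x => .pair (enc x.1) (enc x.2)⟩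

instance {α : Type} [HasVal α] : HasVal (List α) := ⟨encodeList enc⟩

instance {S : Schema} : HasVal (DBFact S) := ⟨encodeFact⟩

/-- The size of the representation of an element. -/
def encSize {α : Type} [HasVal α] (a : α) : ℕ := (enc a).size

theorem Val.size_pos (v : Val) : 0 < v.size := by cases v <;> simp [Val.size]

section
variable {α β γ δ σ : Type} [HasVal α] [HasVal β] [HasVal γ] [HasVal δ] [HasVal σ]

theorem encSize_pos (a : α) : 0 < encSize a := Val.size_pos _

theorem encSize_pair (a : α) (b : β) : encSize (a, b) = encSize a + encSize b + 1 := rfl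

theorem encSize_nil : encSize ([] : List α) = 1 := by
  simp [encSize, enc, encodeList, Val.size]

theorem encSize_cons (a : α) (l : List α) : encSize (a :: l) = encSize a + encSize l + 1 := rfl

theorem encSize_nat (n : ℕ) : encSize n = Nat.size n + 1 := rfl

theorem encSize_bool (b : Bool) : encSize b ≤ 2 := by
  cases b <;> simp [encSize, enc, Val.size]

theorem encSize_append (l l' : List α) : encSize (l ++ l') ≤ encSize l + encSize l' := by
  induction l with
  | nil => simp [encSize_nil]
  | cons a l ih => simp only [List.cons_append, encSize_cons]; omega

theorem length_lt_encSize (l : List α) : l.length < encSize l := by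
  induction l with
  | nil => simp [encSize_nil]
  | cons a l ih => simp only [List.length_cons, encSize_cons]; have := encSize_pos a; omega

theorem encSize_le_of_sublist {l l' : List α} (h : l.Sublist l') : encSize l ≤ encSize l' := by
  induction h with
  | slnil => rfl
  | cons a _ ih => simp only [encSize_cons]; omega
  | cons_cons a _ ih => simp only [encSize_cons]; omega

theorem encSize_nat_mono {m n : ℕ} (h : m ≤ n) : encSize m ≤ encSize n := by
  simp only [encSize_nat]; have := Nat.size_le_size h; omega

theorem encSize_nat_add (m n : ℕ) : encSize (m + n) ≤ encSize m + encSize n := by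
  simp only [encSize_nat]
  have : Nat.size (m + n) ≤ m.size + n.size := by
    rcases Nat.eq_zero_or_pos m with rfl | hm
    · simp
    rcases Nat.eq_zero_or_pos n with rfl | hn
    · simp
    rw [Nat.size_le]
    have h1 := Nat.lt_size_self m
    have h2 := Nat.lt_size_self n
    have : m + n ≤ 2 ^ m.size * 2 ^ n.size - 1 := by
      have h3 : m + 1 ≤ 2 ^ m.size := h1
      have h4 : n + 1 ≤ 2 ^ n.size := h2
      have := Nat.mul_le_mul h3 h4
      have : 0 < m * n := Nat.mul_pos hm hn
      have : (m + 1) * (n + 1) = m * n + m + n + 1 := by ring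
      omega
    rw [pow_add]
    have : 0 < 2 ^ m.size * 2 ^ n.size := by positivity
    omega
  omega

theorem encSize_nat_mul (m n : ℕ) : encSize (m * n) ≤ encSize m + encSize n := by
  simp only [encSize_nat]
  have : Nat.size (m * n) ≤ m.size + n.size := by
    rw [Nat.size_le, pow_add]
    exact Nat.mul_lt_mul'' (Nat.lt_size_self m) (Nat.lt_size_self n)
  omega

/-- `p` computes the value `w` from `v` deterministically in time at most `t`. -/
def Prog.Computes (p : Prog) (v w : Val) (t : ℕ) : Prop := p.Run v (PMF.pure w) t

/-! ### Deterministic runs and closure properties of polynomial time. -/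

theorem Prog.Computes.mono {p : Prog} {v w : Val} {s t : ℕ} (h : p.Computes v w s) (hst : s ≤ t) :
    p.Computes v w t := Prog.Run.mono h hst

theorem Prog.Computes.op (o : Op) (v : Val) : (Prog.op o).Computes v (o.apply v) v.size :=
  Prog.Run.op o v

theorem Prog.Computes.pair {p q : Prog} {v a b : Val} {s t : ℕ} (hp : p.Computes v a s)
    (hq : q.Computes v b t) : (Prog.pair p q).Computes v (.pair a b) (v.size + s + t) := by
  have := Prog.Run.pair hp hq
  simp only [PMF.pure_bind] at this
  exact this

theorem Prog.Computes.seq {p q : Prog} {v a b : Val} {s t : ℕ} (hp : p.Computes v a s)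
    (hq : q.Computes a b t) : (Prog.seq p q).Computes v b (v.size + s + t) := by
  have := Prog.Run.seq (q := q) (ν := fun _ => PMF.pure b) (t := t) hp (by
    intro w hw
    obtain rfl : w = a := by simpa using hw
    exact hq)
  simp only [PMF.pure_bind] at this
  exact this

theorem Prog.Computes.cond_true {b p q : Prog} {v a w : Val} {s t : ℕ} (hb : b.Computes v a s)
    (ha : a ≠ .num 0) (hp : p.Computes v w t) :
    (Prog.cond b p q).Computes v w (v.size + s + t) := by
  have := Prog.Run.cond (p := p) (q := q) (ν := fun _ => PMF.pure w) (t := t) hb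
    (by intro w' _ _; exact hp)
    (by intro w' hw' h0
        obtain rfl : w' = a := by simpa using hw'
        exact absurd h0 ha)
  simp only [PMF.pure_bind] at this
  exact this

theorem Prog.Computes.cond_false {b p q : Prog} {v w : Val} {s t : ℕ}
    (hb : b.Computes v (.num 0) s) (hq : q.Computes v w t) :
    (Prog.cond b p q).Computes v w (v.size + s + t) := by
  have := Prog.Run.cond (p := p) (q := q) (ν := fun _ => PMF.pure w) (t := t) hb
    (by intro w' hw' h0
        obtain rfl : w' = Val.num 0 := by simpa using hw'
        exact absurd rfl h0)
    (by intro w' _ _; exact hq)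
  simp only [PMF.pure_bind] at this
  exact this

/-- `f` is computed by a deterministic program in polynomial time. -/
@[fun_prop]
def Polytime (f : α → β) : Prop :=
  ∃ (p : Prog) (pol : Polynomial ℕ), p.Deterministic ∧
    ∀ a, p.Computes (enc a) (enc (f a)) (pol.eval (encSize a)) ∧
      encSize (f a) ≤ pol.eval (encSize a)

/-- A polynomial that bounds the size of the outcomes of `f`. -/
theorem Polytime.exists_size {f : α → β} (hf : Polytime f) :
    ∃ pol : Polynomial ℕ, ∀ a, encSize (f a) ≤ pol.eval (encSize a) := by
  obtain ⟨p, pol, -, h⟩ := hf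
  exact ⟨pol, fun a => (h a).2⟩

theorem Polytime.of_bounds {f : α → β} (p : Prog) (pol pol' : Polynomial ℕ) (hp : p.Deterministic)
    (h : ∀ a, p.Computes (enc a) (enc (f a)) (pol.eval (encSize a)))
    (h' : ∀ a, encSize (f a) ≤ pol'.eval (encSize a)) : Polytime f := by
  refine ⟨p, pol + pol', hp, fun a => ⟨(h a).mono ?_, (h' a).trans ?_⟩⟩ <;> simp

theorem Polytime.of_op {f : α → β} (o : Op) (pol : Polynomial ℕ)
    (h : ∀ a, o.apply (enc a) = enc (f a))
    (h' : ∀ a, encSize (f a) ≤ pol.eval (encSize a)) : Polytime f := by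
  refine Polytime.of_bounds (.op o) Polynomial.X pol trivial (fun a => ?_) h'
  rw [← h a]
  rw [Polynomial.eval_X]
  exact Prog.Computes.op o (enc a)

@[fun_prop]
theorem Polytime.id : Polytime (fun a : α => a) :=
  Polytime.of_op .id Polynomial.X (fun _ => rfl) (by simp)

@[fun_prop]
theorem Polytime.const (b : β) : Polytime (fun _ : α => b) :=
  Polytime.of_op (.const (enc b)) (Polynomial.C (encSize b)) (fun _ => rfl) (by simp)

-- The output bound carried by `Polytime` is what the second program needs: its time is polynomial
-- in an intermediate value of polynomial size.
@[fun_prop]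
theorem Polytime.comp {f : β → γ} {g : α → β} (hf : Polytime f) (hg : Polytime g) :
    Polytime (fun a => f (g a)) := by
  obtain ⟨p, P, hp, hP⟩ := hf
  obtain ⟨q, Q, hq, hQ⟩ := hg
  refine Polytime.of_bounds (.seq q p) (Polynomial.X + Q + P.comp Q) (P.comp Q) ⟨hq, hp⟩
    (fun a => ?_) fun a => ?_
  · refine ((hQ a).1.seq (hP (g a)).1).mono ?_
    simp only [Polynomial.eval_add, Polynomial.eval_X, Polynomial.eval_comp]
    have := P.eval_mono_nat (hQ a).2
    unfold encSize at *
    omega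
  · rw [Polynomial.eval_comp]
    exact (hP _).2.trans (P.eval_mono_nat (hQ a).2)

@[fun_prop]
theorem Polytime.prodMk {f : α → β} {g : α → γ} (hf : Polytime f) (hg : Polytime g) :
    Polytime (fun a => (f a, g a)) := by
  obtain ⟨p, P, hp, hP⟩ := hf
  obtain ⟨q, Q, hq, hQ⟩ := hg
  refine Polytime.of_bounds (.pair p q) (Polynomial.X + P + Q) (P + Q + 1) ⟨hp, hq⟩
    (fun a => ?_) fun a => ?_
  · refine ((hP a).1.pair (hQ a).1).mono ?_
    simp [encSize]
  · have := (hP a).2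
    have := (hQ a).2
    simp only [encSize_pair, Polynomial.eval_add, Polynomial.eval_one]
    omega

theorem Polytime.fst_aux : Polytime (fun x : α × β => x.1) :=
  Polytime.of_op .fst Polynomial.X (fun _ => rfl)
    (fun a => by rw [Polynomial.eval_X, encSize_pair]; omega)

theorem Polytime.snd_aux : Polytime (fun x : α × β => x.2) :=
  Polytime.of_op .snd Polynomial.X (fun _ => rfl)
    (fun a => by rw [Polynomial.eval_X, encSize_pair]; omega)

@[fun_prop]
theorem Polytime.fst {f : α → β × γ} (hf : Polytime f) : Polytime (fun a => (f a).1) :=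
  Polytime.fst_aux.comp hf

@[fun_prop]
theorem Polytime.snd {f : α → β × γ} (hf : Polytime f) : Polytime (fun a => (f a).2) :=
  Polytime.snd_aux.comp hf

-- A nonempty list is encoded as the pair of its head and tail, so the program for pairs serves
-- unchanged.
@[fun_prop]
theorem Polytime.cons {f : α → β} {g : α → List β} (hf : Polytime f) (hg : Polytime g) :
    Polytime (fun a => f a :: g a) := by
  obtain ⟨p, P, hp, hP⟩ := hf.prodMk hg
  exact ⟨p, P, hp, hP⟩

@[fun_prop]
theorem Polytime.add {f g : α → ℕ} (hf : Polytime f) (hg : Polytime g) :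
    Polytime (fun a => f a + g a) := by
  have : Polytime (fun x : ℕ × ℕ => x.1 + x.2) :=
    Polytime.of_op .add Polynomial.X (fun _ => rfl) fun a => by
      have := encSize_nat_add a.1 a.2
      rw [Polynomial.eval_X, encSize_pair]; omega
  exact this.comp (hf.prodMk hg)

@[fun_prop]
theorem Polytime.mul {f g : α → ℕ} (hf : Polytime f) (hg : Polytime g) :
    Polytime (fun a => f a * g a) := by
  have : Polytime (fun x : ℕ × ℕ => x.1 * x.2) :=
    Polytime.of_op .mul Polynomial.X (fun _ => rfl) fun a => by
      have := encSize_nat_mul a.1 a.2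
      rw [Polynomial.eval_X, encSize_pair]; omega
  exact this.comp (hf.prodMk hg)

@[fun_prop]
theorem Polytime.sub {f g : α → ℕ} (hf : Polytime f) (hg : Polytime g) :
    Polytime (fun a => f a - g a) := by
  have : Polytime (fun x : ℕ × ℕ => x.1 - x.2) :=
    Polytime.of_op .sub Polynomial.X (fun _ => rfl) fun a => by
      have := encSize_nat_mono (Nat.sub_le a.1 a.2)
      rw [Polynomial.eval_X, encSize_pair]; omega
  exact this.comp (hf.prodMk hg)

theorem enc_true_ne : enc true ≠ Val.num 0 := by simp [enc]

theorem enc_false : enc false = Val.num 0 := by simp [enc]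

@[fun_prop]
theorem Polytime.bcond {b : α → Bool} {f g : α → β} (hb : Polytime b) (hf : Polytime f)
    (hg : Polytime g) : Polytime (fun a => bif b a then f a else g a) := by
  obtain ⟨r, R, hr, hR⟩ := hb
  obtain ⟨p, P, hp, hP⟩ := hf
  obtain ⟨q, Q, hq, hQ⟩ := hg
  refine Polytime.of_bounds (.cond r p q) (Polynomial.X + R + P + Q) (P + Q) ⟨hr, hp, hq⟩
    (fun a => ?_) fun a => ?_
  · simp only [Polynomial.eval_add, Polynomial.eval_X]
    cases h : b a with
    | true =>
      refine ((hR a).1.cond_true (by rw [h]; exact enc_true_ne) (hP a).1).mono ?_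
      unfold encSize; omega
    | false =>
      have := (hR a).1
      rw [h, enc_false] at this
      refine (this.cond_false (hQ a).1).mono ?_
      unfold encSize; omega
  · have h1 := (hP a).2
    have h2 := (hQ a).2
    simp only [Polynomial.eval_add]
    cases b a
    · exact h2.trans (Nat.le_add_left _ _)
    · exact h1.trans (Nat.le_add_right _ _)

@[fun_prop]
theorem Polytime.and {f g : α → Bool} (hf : Polytime f) (hg : Polytime g) :
    Polytime (fun a => f a && g a) := by
  have : Polytime (fun a => bif f a then g a else false) := by fun_prop
  convert this using 2 with a
  cases f a <;> rfl

@[fun_prop]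
theorem Polytime.or {f g : α → Bool} (hf : Polytime f) (hg : Polytime g) :
    Polytime (fun a => f a || g a) := by
  have : Polytime (fun a => bif f a then true else g a) := by fun_prop
  convert this using 2 with a
  cases f a <;> rfl

@[fun_prop]
theorem Polytime.not {f : α → Bool} (hf : Polytime f) : Polytime (fun a => !(f a)) := by
  have : Polytime (fun a => bif f a then false else true) := by fun_prop
  convert this using 2 with a
  cases f a <;> rfl

@[fun_prop]
theorem Polytime.le {f g : α → ℕ} (hf : Polytime f) (hg : Polytime g) :
    Polytime (fun a => decide (f a ≤ g a)) := by
  -- Truncated subtraction reduces comparison to a test for zero, and `cond` can branch on the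
  -- number itself.
  have : Polytime (fun n : ℕ => decide (n = 0)) := by
    refine Polytime.of_bounds (.cond (.op .id) (.op (.const (.num 0))) (.op (.const (.num 1))))
      (3 * Polynomial.X) 2 ⟨trivial, trivial, trivial⟩ (fun n => ?_) fun n => ?_
    · rcases Nat.eq_zero_or_pos n with rfl | hn
      · refine ((Prog.Computes.op .id (.num 0)).cond_false (Prog.Computes.op _ _)).mono ?_
        simp [encSize, enc, Val.size]
      · have h0 : n ≠ 0 := by omega
        refine Prog.Computes.mono (s := (Val.num n).size + (Val.num n).size + (Val.num n).size) ?_ ?_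
        · have : enc (decide (n = 0)) = Val.num 0 := by simp [enc, h0]
          rw [this]
          exact (Prog.Computes.op .id (.num n)).cond_true (by simpa [Op.apply] using h0)
            (Prog.Computes.op (.const (.num 0)) _)
        · simp [encSize, enc]; omega
    · simpa using encSize_bool _
  have h : Polytime (fun a => decide (f a - g a = 0)) := this.comp (hf.sub hg)
  simpa only [Nat.sub_eq_zero_iff_le] using h

@[fun_prop]
theorem Polytime.natEq {f g : α → ℕ} (hf : Polytime f) (hg : Polytime g) :
    Polytime (fun a => decide (f a = g a)) := by
  have : Polytime (fun a => decide (f a ≤ g a) && decide (g a ≤ f a)) := by fun_prop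
  convert this using 2 with a
  rw [← Bool.decide_and]
  exact decide_eq_decide.2 Nat.eq_iff_le_and_ge

end

/-- Recursion over a list with an accumulator and access to the remaining list. -/
def List.para {α σ : Type} (f : σ → α → List α → σ) : σ → List α → σ
  | s, [] => s
  | s, x :: l => List.para f (f s x l) l

/-- Every step adds at most B, whatever the accumulator, so the growth is linear in the length of
the list and does not compound. -/
theorem encSize_para_le {α σ : Type} [HasVal σ] {f : σ → α → List α → σ} {l : List α} {B : ℕ}
    (h : ∀ s x l', (x :: l') <:+ l → encSize (f s x l') ≤ encSize s + B) (s : σ) :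
    encSize (l.para f s) ≤ encSize s + l.length * B := by
  induction l generalizing s with
  | nil => simp [List.para]
  | cons x l ih =>
    have h1 := ih (fun s x l' hl => h s x l' (hl.trans (List.suffix_cons _ _))) (f s x l)
    have h2 := h s x l List.suffix_rfl
    simp only [List.para, List.length_cons, Nat.add_mul, Nat.one_mul]
    omega

/-! ### List recursion in polynomial time. -/

section
variable {α β γ δ σ : Type} [HasVal α] [HasVal β] [HasVal γ] [HasVal δ] [HasVal σ]

theorem encSize_le_of_suffix {l l' : List α} (h : l <:+ l') : encSize l ≤ encSize l' :=
  encSize_le_of_sublist h.sublist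

/-- The loop state is the triple of parameter, accumulator and remaining list; the test `isPair`
works because `[]` is encoded as a number. The state size plus B times the remaining length never
increases, so M bounds every state. The term 18 * M pays for the fixed projections and pairings of a
round. -/
theorem computes_para_loop {f : δ → σ → α → List α → σ} {p : Prog} {P : Polynomial ℕ}
    (hP : ∀ y : δ × σ × α × List α,
      p.Computes (enc y) (enc (f y.1 y.2.1 y.2.2.1 y.2.2.2)) (P.eval (encSize y)))
    (d : δ) (B M : ℕ) (l : List α) (s : σ)
    (h : ∀ s x l', (x :: l') <:+ l → encSize (f d s x l') ≤ encSize s + B)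
    (hM : encSize (d, s, l) + l.length * B ≤ M) :
    (Prog.loop (.seq (.op .snd) (.seq (.op .snd) (.op .isPair)))
      (.pair (.op .fst) (.pair p (.seq (.op .snd) (.seq (.op .snd) (.op .snd)))))).Computes
      (enc (d, s, l)) (enc (d, l.para (f d) s, ([] : List α)))
      ((l.length + 1) * (P.eval M + 18 * M)) := by
  induction l generalizing s with
  | nil =>
    refine Prog.Run.loop ?_
    refine Prog.Computes.mono (s := _) (Prog.Computes.cond_false (w := enc (d, s, ([] : List α)))
      (((Prog.Computes.op .snd _).seq ((Prog.Computes.op .snd _).seq (Prog.Computes.op .isPair _))))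
      (Prog.Computes.op .id _)) ?_
    simp only [encSize_pair, encSize_nil, List.length_nil, Nat.zero_mul] at hM
    simp [enc, Op.apply, Val.size, encodeList]
    simp only [encSize] at hM
    omega
  | cons x l ih =>
    have hstep := h s x l List.suffix_rfl
    have ih' := ih (f d s x l) (fun s x l' hl => h s x l' (hl.trans (List.suffix_cons _ _))) (by
      simp only [encSize_pair, encSize_cons, List.length_cons, Nat.add_mul, Nat.one_mul] at hM ⊢
      omega)
    have hpm : P.eval (encSize (d, s, x, l)) ≤ P.eval M := P.eval_mono_nat (by
      simp only [encSize_pair, encSize_cons] at hM ⊢; omega)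
    refine Prog.Run.loop ?_
    refine Prog.Computes.mono (s := _) (Prog.Computes.cond_true
      (((Prog.Computes.op .snd _).seq ((Prog.Computes.op .snd _).seq (Prog.Computes.op .isPair _))))
      (by simp [enc, Op.apply, encodeList])
      (((Prog.Computes.op .fst _).pair ((hP (d, s, x, l)).pair
        ((Prog.Computes.op .snd _).seq ((Prog.Computes.op .snd _).seq
          (Prog.Computes.op .snd _))))).seq ih')) ?_
    have e1 : (enc (d, s, x :: l)).size ≤ M := by
      have : (enc (d, s, x :: l)).size = encSize (d, s, x :: l) := rfl
      omega
    simp only [List.length_cons, Nat.add_mul, Nat.one_mul] at hM ⊢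
    simp only [encSize_pair, encSize_cons] at hM hpm
    simp only [encSize, enc, encodeList, Val.size, Op.apply] at e1 hM hpm ⊢
    omega

/-- The growth bound must not depend on the accumulator: otherwise polynomially many steps could
produce values of exponential size. -/
theorem Polytime.para {f : δ → σ → α → List α → σ} {s : δ → σ} {l : δ → List α}
    (hf : Polytime (fun y : δ × σ × α × List α => f y.1 y.2.1 y.2.2.1 y.2.2.2))
    (hgrow : ∃ pol : Polynomial ℕ, ∀ d s x l,
      encSize (f d s x l) ≤ encSize s + pol.eval (encSize d + encSize x + encSize l))
    (hs : Polytime s) (hl : Polytime l) :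
    Polytime (fun d => (l d).para (f d) (s d)) := by
  have key : Polytime (fun y : δ × σ × List α => y.2.2.para (f y.1) y.2.1) := by
    obtain ⟨p, P, hp, hP⟩ := hf
    obtain ⟨G, hG⟩ := hgrow
    have hB : ∀ (d : δ) (s : σ) (l : List α), ∀ s' x l', (x :: l') <:+ l →
        encSize (f d s' x l') ≤ encSize s' + G.eval (encSize (d, s, l)) := by
      intro d s l s' x l' hl
      refine (hG _ _ _ _).trans ?_
      gcongr
      refine G.eval_mono_nat ?_
      have := encSize_le_of_suffix hl
      simp only [encSize_pair, encSize_cons] at *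
      omega
    have hlen : ∀ (d : δ) (s : σ) (l : List α), l.length < encSize (d, s, l) := by
      intro d s l
      have := length_lt_encSize l
      simp only [encSize_pair]; omega
    -- With n the input size there are fewer than n rounds, each adding at most G(n); thus M bounds
    -- all states and T the time of the loop.
    let M : Polynomial ℕ := Polynomial.X + Polynomial.X * G
    let T : Polynomial ℕ := Polynomial.X * (P.comp M + 18 * M)
    have hMe : ∀ n, M.eval n = n + n * G.eval n := by intro n; simp [M]
    have hfin : ∀ (d : δ) (s : σ) (l : List α),
        encSize (l.para (f d) s) ≤ encSize s + l.length * G.eval (encSize (d, s, l)) :=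
      fun d s l => encSize_para_le (hB d s l) s
    refine Polytime.of_bounds
      (.seq (.loop (.seq (.op .snd) (.seq (.op .snd) (.op .isPair)))
        (.pair (.op .fst) (.pair p (.seq (.op .snd) (.seq (.op .snd) (.op .snd))))))
        (.seq (.op .snd) (.op .fst))) (Polynomial.X + T + 3 * (M + 1)) M
      ⟨⟨⟨trivial, trivial, trivial⟩, trivial, hp, trivial, trivial, trivial⟩, trivial, trivial⟩
      (fun ⟨d, s, l⟩ => ?_) fun ⟨d, s, l⟩ => ?_
    · have hM : encSize (d, s, l) + l.length * G.eval (encSize (d, s, l))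
          ≤ M.eval (encSize (d, s, l)) := by
        rw [hMe]; have := (hlen d s l).le; gcongr
      have h1 := computes_para_loop (fun y => (hP y).1) d _ _ l s (hB d s l) hM
      refine (h1.seq ((Prog.Computes.op .snd _).seq (Prog.Computes.op .fst _))).mono ?_
      have h2 : (l.length + 1) * (P.eval (M.eval (encSize (d, s, l))) +
          18 * M.eval (encSize (d, s, l))) ≤ T.eval (encSize (d, s, l)) := by
        simp only [T, Polynomial.eval_mul, Polynomial.eval_X, Polynomial.eval_add,
          Polynomial.eval_comp, Polynomial.eval_ofNat]
        have := hlen d s l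
        gcongr
        omega
      have h3 := hfin d s l
      have h4 : encSize d + encSize s + encSize l + 2 = encSize (d, s, l) := by
        simp only [encSize_pair]; omega
      have h5 := encSize_pos l
      simp only [Polynomial.eval_add, Polynomial.eval_X, Polynomial.eval_mul,
        Polynomial.eval_ofNat, Polynomial.eval_one]
      have h6 : (enc (d, s, l)).size = encSize (d, s, l) := rfl
      have h7 : (enc (d, l.para (f d) s, ([] : List α))).size
          = encSize d + (encSize (l.para (f d) s) + 1 + 1) + 1 := rfl
      have h8 : (Op.snd.apply (enc (d, l.para (f d) s, ([] : List α)))).size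
          = encSize (l.para (f d) s) + 1 + 1 := rfl
      omega
    · rw [hMe]
      refine (hfin d s l).trans ?_
      have := (hlen d s l).le
      have h4 : encSize s ≤ encSize (d, s, l) := by
        simp only [encSize_pair]; omega
      show encSize s + l.length * G.eval (encSize (d, s, l)) ≤ _
      gcongr
  exact key.comp (Polytime.id.prodMk (hs.prodMk hl))

end

/-! ## Polynomial-time list operations -/

section
variable {α β γ δ σ : Type} [HasVal α] [HasVal β] [HasVal γ] [HasVal δ] [HasVal σ]

theorem List.para_eq_foldl {α σ : Type} (f : σ → α → σ) (s : σ) (l : List α) :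
    l.para (fun s x _ => f s x) s = l.foldl f s := by
  induction l generalizing s with
  | nil => rfl
  | cons x l ih => exact ih _

theorem Polytime.foldl {f : δ → σ → α → σ} {s : δ → σ} {l : δ → List α}
    (hf : Polytime (fun y : δ × σ × α => f y.1 y.2.1 y.2.2))
    (hgrow : ∃ pol : Polynomial ℕ, ∀ d s x,
      encSize (f d s x) ≤ encSize s + pol.eval (encSize d + encSize x))
    (hs : Polytime s) (hl : Polytime l) :
    Polytime (fun d => (l d).foldl (f d) (s d)) := by
  simp only [← List.para_eq_foldl]
  refine Polytime.para (f := fun d s x _ => f d s x) ?_ ?_ hs hl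
  · exact hf.comp (f := fun y : δ × σ × α => f y.1 y.2.1 y.2.2)
      (g := fun y : δ × σ × α × List α => (y.1, y.2.1, y.2.2.1)) (by fun_prop)
  · obtain ⟨P, hP⟩ := hgrow
    refine ⟨P, fun d s x l => (hP d s x).trans ?_⟩
    have := P.eval_mono_nat (Nat.le_add_right (encSize d + encSize x) (encSize l))
    omega

@[fun_prop]
theorem Polytime.reverse {l : δ → List α} (hl : Polytime l) :
    Polytime (fun d => (l d).reverse) := by
  have h := Polytime.foldl (f := fun (_ : δ) (s : List α) x => x :: s) (s := fun _ => [])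
    (by fun_prop) ⟨Polynomial.X + 1, fun d s x => by
      simp only [encSize_cons, Polynomial.eval_add, Polynomial.eval_X, Polynomial.eval_one]
      omega⟩ (by fun_prop) hl
  simpa using h

@[fun_prop]
theorem Polytime.append {l l' : δ → List α} (hl : Polytime l) (hl' : Polytime l') :
    Polytime (fun d => l d ++ l' d) := by
  have h := Polytime.foldl (f := fun (_ : δ) (s : List α) x => x :: s) (s := l')
    (l := fun d => (l d).reverse)
    (by fun_prop) ⟨Polynomial.X + 1, fun d s x => by
      simp only [encSize_cons, Polynomial.eval_add, Polynomial.eval_X, Polynomial.eval_one]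
      omega⟩ hl' (by fun_prop)
  simpa using h

@[fun_prop]
theorem Polytime.map {f : δ → α → β} {l : δ → List α}
    (hf : Polytime (fun y : δ × α => f y.1 y.2)) (hl : Polytime l) :
    Polytime (fun d => (l d).map (f d)) := by
  obtain ⟨P, hP⟩ := hf.exists_size
  have h := (Polytime.foldl (f := fun (d : δ) (s : List β) x => f d x :: s) (s := fun _ => [])
    ((hf.comp (g := fun y : δ × List β × α => (y.1, y.2.2)) (by fun_prop)).cons (by fun_prop))
    ⟨P.comp (Polynomial.X + 1) + 1, fun d s x => by
      have := hP (d, x)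
      simp only [encSize_cons, encSize_pair, Polynomial.eval_add, Polynomial.eval_X,
        Polynomial.eval_one, Polynomial.eval_comp] at *
      omega⟩ (by fun_prop) hl).reverse
  convert h using 2 with d
  have : ∀ (l : List α) (s : List β),
      l.foldl (fun s x => f d x :: s) s = (l.map (f d)).reverse ++ s := by
    intro l
    induction l with
    | nil => simp
    | cons x l ih => intro s; simp [ih]
  simp [this]

@[fun_prop]
theorem Polytime.filter {f : δ → α → Bool} {l : δ → List α}
    (hf : Polytime (fun y : δ × α => f y.1 y.2)) (hl : Polytime l) :
    Polytime (fun d => (l d).filter (f d)) := by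
  have hf' : Polytime (fun y : δ × List α × α => f y.1 y.2.2) :=
    hf.comp (g := fun y : δ × List α × α => (y.1, y.2.2)) (by fun_prop)
  have h := (Polytime.foldl (f := fun (d : δ) (s : List α) x => bif f d x then x :: s else s)
    (s := fun _ => []) (by fun_prop)
    ⟨Polynomial.X + 1, fun d s x => by
      cases f d x <;> simp only [cond_true, cond_false, encSize_cons, Polynomial.eval_add,
        Polynomial.eval_X, Polynomial.eval_one] <;> omega⟩ (by fun_prop) hl).reverse
  convert h using 2 with d
  have : ∀ (l : List α) (s : List α),
      l.foldl (fun s x => bif f d x then x :: s else s) s = (l.filter (f d)).reverse ++ s := by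
    intro l
    induction l with
    | nil => simp
    | cons x l ih => intro s; cases hx : f d x <;> simp [ih, hx]
  simp [this]

@[fun_prop]
theorem Polytime.all {f : δ → α → Bool} {l : δ → List α}
    (hf : Polytime (fun y : δ × α => f y.1 y.2)) (hl : Polytime l) :
    Polytime (fun d => (l d).all (f d)) := by
  have hf' : Polytime (fun y : δ × Bool × α => f y.1 y.2.2) :=
    hf.comp (g := fun y : δ × Bool × α => (y.1, y.2.2)) (by fun_prop)
  have h := Polytime.foldl (f := fun (d : δ) (s : Bool) x => s && f d x)
    (s := fun _ => true) (by fun_prop)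
    ⟨2, fun d s x => (encSize_bool _).trans (by simp)⟩ (by fun_prop) hl
  convert h using 2 with d
  have : ∀ (l : List α) (s : Bool), l.foldl (fun s x => s && f d x) s = (s && l.all (f d)) := by
    intro l
    induction l with
    | nil => simp
    | cons x l ih => intro s; simp [ih, Bool.and_assoc]
  simp [this]

@[fun_prop]
theorem Polytime.any {f : δ → α → Bool} {l : δ → List α}
    (hf : Polytime (fun y : δ × α => f y.1 y.2)) (hl : Polytime l) :
    Polytime (fun d => (l d).any (f d)) := by
  have h : Polytime (fun d => !((l d).all (fun x => !(f d x)))) := by fun_prop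
  convert h using 2 with d
  simp [List.any_eq_not_all_not]

@[fun_prop]
theorem Polytime.sum {l : δ → List ℕ} (hl : Polytime l) : Polytime (fun d => (l d).sum) := by
  have h := Polytime.foldl (f := fun (_ : δ) (s : ℕ) x => s + x)
    (s := fun _ => 0) (by fun_prop)
    ⟨Polynomial.X, fun d s x => (encSize_nat_add _ _).trans (by simp)⟩ (by fun_prop) hl
  simpa only [List.sum_eq_foldl] using h

-- Bit lengths are subadditive under multiplication, so each factor adds at most its own size to the
-- accumulator.
@[fun_prop]
theorem Polytime.prod {l : δ → List ℕ} (hl : Polytime l) : Polytime (fun d => (l d).prod) := by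
  have h := Polytime.foldl (f := fun (_ : δ) (s : ℕ) x => s * x)
    (s := fun _ => 1) (by fun_prop)
    ⟨Polynomial.X, fun d s x => (encSize_nat_mul _ _).trans (by simp)⟩ (by fun_prop) hl
  simpa only [List.prod_eq_foldl] using h

/-- The list L is not part of the input: the program is a fixed conjunction, so the tests may vary
arbitrarily with the index. -/
theorem Polytime.forall_mem_list {ι : Type} {f : ι → δ → Bool} (hf : ∀ i, Polytime (f i))
    (L : List ι) : Polytime (fun d => L.all (fun i => f i d)) := by
  induction L with
  | nil => simpa using Polytime.const true
  | cons i L ih => simpa using (hf i).and ih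

end

/-! ## Polynomial-time access to facts -/

section
variable {S : Schema} {δ : Type} [HasVal δ]

/-- The `i`-th constant of a fact, and `0` if there is none. -/
def DBFact.get (f : DBFact S) (i : ℕ) : ℕ := (List.ofFn f.2).getD i 0

theorem Polytime.rel {g : δ → DBFact S} (hg : Polytime g) :
    Polytime (fun d => ((g d).1 : ℕ)) := by
  have : Polytime (fun f : DBFact S => (f.1 : ℕ)) :=
    Polytime.of_op .fst Polynomial.X (fun _ => rfl) fun f => by
      rw [Polynomial.eval_X]
      show _ ≤ encSize ((f.1 : ℕ), List.ofFn f.2)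
      rw [encSize_pair]; omega
  exact this.comp hg

theorem Polytime.args {g : δ → DBFact S} (hg : Polytime g) :
    Polytime (fun d => List.ofFn (g d).2) := by
  have : Polytime (fun f : DBFact S => List.ofFn f.2) :=
    Polytime.of_op .snd Polynomial.X (fun _ => rfl) fun f => by
      rw [Polynomial.eval_X]
      show _ ≤ encSize ((f.1 : ℕ), List.ofFn f.2)
      rw [encSize_pair]; omega
  exact this.comp hg

/-- On the encoding `num 0` of the empty list, `fst` returns `num 0`, which is the default value
here. -/
theorem Polytime.headD {l : δ → List ℕ} (hl : Polytime l) :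
    Polytime (fun d => (l d).headD 0) := by
  have : Polytime (fun l : List ℕ => l.headD 0) :=
    Polytime.of_op .fst Polynomial.X (fun l => by cases l <;> rfl) fun l => by
      rw [Polynomial.eval_X]
      cases l with
      | nil => simp [encSize, enc, Val.size, encodeList]
      | cons a l => simp only [List.headD_cons, encSize_cons]; omega
  exact this.comp hl

theorem Polytime.tail {l : δ → List ℕ} (hl : Polytime l) :
    Polytime (fun d => (l d).tail) := by
  have : Polytime (fun l : List ℕ => l.tail) :=
    Polytime.of_op .snd Polynomial.X (fun l => by cases l <;> rfl) fun l => by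
      rw [Polynomial.eval_X]
      exact encSize_le_of_sublist (List.tail_sublist l)
  exact this.comp hl

theorem Polytime.getD {l : δ → List ℕ} (hl : Polytime l) (i : ℕ) :
    Polytime (fun d => (l d).getD i 0) := by
  induction i generalizing l with
  | zero =>
    convert hl.headD using 2 with d
    cases l d <;> rfl
  | succ i ih =>
    convert ih hl.tail using 2 with d
    cases l d <;> simp

theorem Polytime.get {g : δ → DBFact S} (hg : Polytime g) (i : ℕ) :
    Polytime (fun d => (g d).get i) := hg.args.getD i

end

/-! ## Counting and unranking maximal independent sets of hierarchical conflict relations -/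

section
variable {α : Type} [DecidableEq α]

/-- `E` is a maximal subset of `F` without conflicts. -/
structure IsMaxIndep (C : α → α → Bool) (F E : Finset α) : Prop where
  subset : E ⊆ F
  indep : ∀ a ∈ E, ∀ b ∈ E, C a b = false
  maximal : ∀ a ∈ F, (∀ b ∈ E, C a b = false) → a ∈ E

theorem IsMaxIndep.nonempty {α : Type} {C : α → α → Bool} {F E : Finset α} (h : IsMaxIndep C F E)
    (hF : F.Nonempty) : E.Nonempty := by
  obtain ⟨a, ha⟩ := hF
  by_contra hE
  rw [Finset.not_nonempty_iff_eq_empty] at hE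
  have := h.maximal a ha (by simp [hE])
  simp [hE] at this

/-- One element of each class of the relation `r` on a list. -/
def List.reps {α : Type} (r : α → α → Bool) : List α → List α
  | [] => []
  | x :: l => bif l.any (r x) then List.reps r l else x :: List.reps r l

/-- The classes of the relation `r` on a list. -/
def List.classes {α : Type} (r : α → α → Bool) (l : List α) : List (List α) :=
  (l.reps r).map fun x => l.filter (r x)

/-- A boolean equivalence relation. -/
structure IsBoolEquiv {α : Type} (r : α → α → Bool) : Prop where
  refl : ∀ a, r a a = true
  symm : ∀ a b, r a b = true → r b a = true
  trans : ∀ a b c, r a b = true → r b c = true → r a c = true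

/-! ### Classes of an equivalence relation on a list. -/

theorem List.mem_of_mem_reps {α : Type} {r : α → α → Bool} {l : List α} {a : α}
    (h : a ∈ l.reps r) : a ∈ l := by
  induction l with
  | nil => exact h
  | cons x l ih =>
    cases hx : l.any (r x) <;> simp only [List.reps, hx, cond_true, cond_false] at h
    · rcases List.mem_cons.1 h with rfl | h
      · simp
      · exact List.mem_cons_of_mem _ (ih h)
    · exact List.mem_cons_of_mem _ (ih h)

theorem List.exists_mem_reps {α : Type} {r : α → α → Bool} (hr : IsBoolEquiv r) {l : List α} {a : α}
    (h : a ∈ l) : ∃ b ∈ l.reps r, r b a = true := by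
  induction l generalizing a with
  | nil => simp at h
  | cons x l ih =>
    cases hx : l.any (r x) <;> simp only [List.reps, hx, cond_true, cond_false]
    · rcases List.mem_cons.1 h with rfl | h
      · exact ⟨a, by simp, hr.refl a⟩
      · obtain ⟨b, hb, hba⟩ := ih h
        exact ⟨b, List.mem_cons_of_mem _ hb, hba⟩
    · rcases List.mem_cons.1 h with rfl | h
      · obtain ⟨c, hc, hac⟩ := List.any_eq_true.1 hx
        obtain ⟨b, hb, hbc⟩ := ih hc
        exact ⟨b, hb, hr.trans _ _ _ hbc (hr.symm _ _ hac)⟩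
      · exact ih h

theorem List.pairwise_reps {α : Type} (r : α → α → Bool) (l : List α) :
    (l.reps r).Pairwise fun a b => r a b = false := by
  induction l with
  | nil => simp [List.reps]
  | cons x l ih =>
    cases hx : l.any (r x) <;> simp only [List.reps, hx, cond_true, cond_false]
    · refine List.pairwise_cons.2 ⟨fun b hb => ?_, ih⟩
      have := List.any_eq_false.1 hx b (List.mem_of_mem_reps hb)
      simpa using this
    · exact ih

theorem List.pairwise_disjoint_classes {α : Type} {r : α → α → Bool} (hr : IsBoolEquiv r)
    (l : List α) : (l.classes r).Pairwise List.Disjoint := by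
  refine List.pairwise_map.2 ((List.pairwise_reps r l).imp fun {a b} hab c hc hc' => ?_)
  have h1 := (List.mem_filter.1 hc).2
  have h2 := (List.mem_filter.1 hc').2
  have := hr.trans _ _ _ h1 (hr.symm _ _ h2)
  simp [this] at hab

theorem List.ne_nil_of_mem_classes {α : Type} {r : α → α → Bool} (hr : IsBoolEquiv r)
    {l x : List α} (h : x ∈ l.classes r) : x ≠ [] := by
  obtain ⟨a, ha, rfl⟩ := List.mem_map.1 h
  exact List.ne_nil_of_mem (List.mem_filter.2 ⟨List.mem_of_mem_reps ha, hr.refl a⟩)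

theorem List.sublist_of_mem_classes {α : Type} {r : α → α → Bool}
    {l x : List α} (h : x ∈ l.classes r) : x.Sublist l := by
  obtain ⟨a, ha, rfl⟩ := List.mem_map.1 h
  exact List.filter_sublist

theorem List.exists_mem_classes {α : Type} {r : α → α → Bool} (hr : IsBoolEquiv r)
    {l : List α} {a : α} (h : a ∈ l) : ∃ x ∈ l.classes r, a ∈ x := by
  obtain ⟨b, hb, hba⟩ := List.exists_mem_reps hr h
  exact ⟨_, List.mem_map.2 ⟨b, hb, rfl⟩, List.mem_filter.2 ⟨h, hba⟩⟩

theorem List.rel_of_mem_classes {α : Type} {r : α → α → Bool} (hr : IsBoolEquiv r)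
    {l x : List α} (hx : x ∈ l.classes r) {a b : α} (ha : a ∈ x) (hb : b ∈ x) : r a b = true := by
  obtain ⟨c, -, rfl⟩ := List.mem_map.1 hx
  exact hr.trans _ _ _ (hr.symm _ _ (List.mem_filter.1 ha).2) (List.mem_filter.1 hb).2

theorem List.mem_of_mem_classes_of_rel {α : Type} {r : α → α → Bool} (hr : IsBoolEquiv r)
    {l x : List α} (hx : x ∈ l.classes r) {a b : α} (ha : a ∈ x) (hb : b ∈ l)
    (hab : r a b = true) : b ∈ x := by
  obtain ⟨c, -, rfl⟩ := List.mem_map.1 hx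
  exact List.mem_filter.2 ⟨hb, hr.trans _ _ _ (List.mem_filter.1 ha).2 hab⟩

/-- `cnt F` is the number of maximal independent sets of `F`, and `r ↦ unr F m r` is a bijection
from `{0, …, cnt F * m - 1}` to the pairs of such a set and a number below `m`. -/
structure Unranks (C : α → α → Bool) (cnt : List α → ℕ) (unr : List α → ℕ → ℕ → List α × ℕ)
    (F : List α) : Prop where
  pos : 0 < cnt F
  sound : ∀ m r, r < cnt F * m → (unr F m r).1.Nodup ∧
    IsMaxIndep C F.toFinset (unr F m r).1.toFinset ∧ (unr F m r).2 < m
  unique : ∀ m E s, IsMaxIndep C F.toFinset E → s < m →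
    ∃! r, r < cnt F * m ∧ (unr F m r).1.toFinset = E ∧ (unr F m r).2 = s

/-- Unranking of a maximal independent set of one of the members of a list. -/
def unrankSum {α : Type} (cnt : List α → ℕ) (unr : List α → ℕ → ℕ → List α × ℕ) (m r : ℕ) :
    List (List α) → List α × ℕ
  | [] => ([], 0)
  | x :: l => bif decide ((l.map cnt).sum * m ≤ r) then unr x m (r - (l.map cnt).sum * m)
    else unrankSum cnt unr m r l

/-- Unranking of a union of maximal independent sets of all members of a list. -/
def unrankProd {α : Type} (cnt : List α → ℕ) (unr : List α → ℕ → ℕ → List α × ℕ) (m : ℕ) :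
    List (List α) → ℕ → List α × ℕ
  | [], r => ([], r)
  | x :: l, r =>
    ((unrankProd cnt unr m l (unr x ((l.map cnt).prod * m) r).2).1 ++
        (unr x ((l.map cnt).prod * m) r).1,
      (unrankProd cnt unr m l (unr x ((l.map cnt).prod * m) r).2).2)

/-! ### Unranking sums and products. -/

variable {C : α → α → Bool} {cnt : List α → ℕ} {unr : List α → ℕ → ℕ → List α × ℕ}

theorem unrankSum_sound {l : List (List α)} (h : ∀ x ∈ l, Unranks C cnt unr x) {m r : ℕ}
    (hr : r < (l.map cnt).sum * m) :
    (unrankSum cnt unr m r l).1.Nodup ∧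
      (∃ x ∈ l, IsMaxIndep C x.toFinset (unrankSum cnt unr m r l).1.toFinset) ∧
      (unrankSum cnt unr m r l).2 < m := by
  induction l with
  | nil => simp at hr
  | cons x l ih =>
    simp only [List.map_cons, List.sum_cons, Nat.add_mul] at hr
    by_cases hT : (l.map cnt).sum * m ≤ r
    · simp only [unrankSum, hT, decide_true, cond_true]
      have := (h x (by simp)).sound m (r - (l.map cnt).sum * m) (by omega)
      exact ⟨this.1, ⟨x, by simp, this.2.1⟩, this.2.2⟩
    · simp only [unrankSum, hT, decide_false, cond_false]
      obtain ⟨h1, ⟨y, hy, h2⟩, h3⟩ := ih (fun y hy => h y (by simp [hy])) (by omega)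
      exact ⟨h1, ⟨y, by simp [hy], h2⟩, h3⟩

/-- The tail owns the numbers below T and the head the next block. Since the members are nonempty
and disjoint, a set is maximal independent in at most one of them, so it determines its block. -/
theorem unrankSum_unique {l : List (List α)} (h : ∀ x ∈ l, Unranks C cnt unr x)
    (hne : ∀ x ∈ l, x ≠ []) (hd : l.Pairwise List.Disjoint) {m s : ℕ} {E : Finset α}
    (hE : ∃ x ∈ l, IsMaxIndep C x.toFinset E) (hs : s < m) :
    ∃! r, r < (l.map cnt).sum * m ∧ (unrankSum cnt unr m r l).1.toFinset = E ∧
      (unrankSum cnt unr m r l).2 = s := by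
  induction l with
  | nil => simp at hE
  | cons x l ih =>
    have hdisj : ∀ y ∈ l, IsMaxIndep C x.toFinset E → IsMaxIndep C y.toFinset E → False := by
      intro y hy h1 h2
      obtain ⟨a, ha⟩ := h1.nonempty ((List.toFinset_nonempty_iff _).2 (hne x (by simp)))
      exact (List.pairwise_cons.1 hd).1 y hy (List.mem_toFinset.1 (h1.subset ha))
        (List.mem_toFinset.1 (h2.subset ha))
    have hl : ∀ y ∈ l, Unranks C cnt unr y := fun y hy => h y (by simp [hy])
    simp only [List.map_cons, List.sum_cons, Nat.add_mul]
    set T := (l.map cnt).sum * m with hTdef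
    have ev1 : ∀ r, T ≤ r → unrankSum cnt unr m r (x :: l) = unr x m (r - T) := by
      intro r hr; simp [unrankSum, ← hTdef, hr]
    have ev2 : ∀ r, ¬ T ≤ r → unrankSum cnt unr m r (x :: l) = unrankSum cnt unr m r l := by
      intro r hr; simp [unrankSum, ← hTdef, hr]
    have hx := h x (by simp)
    by_cases hxE : IsMaxIndep C x.toFinset E
    · obtain ⟨r, ⟨hr1, hr2, hr3⟩, hu⟩ := hx.unique m E s hxE hs
      refine ⟨T + r, ⟨by omega, ?_, ?_⟩, ?_⟩
      · rw [ev1 _ (by omega), Nat.add_sub_cancel_left, hr2]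
      · rw [ev1 _ (by omega), Nat.add_sub_cancel_left, hr3]
      · rintro r' ⟨h1, h2, h3⟩
        by_cases hT : T ≤ r'
        · rw [ev1 _ hT] at h2 h3
          have := hu (r' - T) ⟨by omega, h2, h3⟩
          omega
        · rw [ev2 _ hT] at h2
          obtain ⟨-, ⟨y, hy, hyE⟩, -⟩ := unrankSum_sound hl (m := m) (r := r') (by omega)
          rw [h2] at hyE
          exact (hdisj y hy hxE hyE).elim
    · obtain ⟨y, hy, hyE⟩ := hE
      have hyl : y ∈ l := by
        rcases List.mem_cons.1 hy with rfl | hy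
        · exact absurd hyE hxE
        · exact hy
      obtain ⟨r, ⟨hr1, hr2, hr3⟩, hu⟩ := ih hl (fun y hy => hne y (by simp [hy]))
        (List.pairwise_cons.1 hd).2 ⟨y, hyl, hyE⟩
      refine ⟨r, ⟨by omega, ?_, ?_⟩, ?_⟩
      · rw [ev2 _ (by omega), hr2]
      · rw [ev2 _ (by omega), hr3]
      · rintro r' ⟨h1, h2, h3⟩
        by_cases hT : T ≤ r'
        · rw [ev1 _ hT] at h2
          have := (hx.sound m (r' - T) (by omega)).2.1
          rw [h2] at this
          exact absurd this hxE
        · rw [ev2 _ hT] at h2 h3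
          exact hu r' ⟨by omega, h2, h3⟩

/-- `E` is a union of maximal independent sets of all members of `l`. -/
def IsMaxIndepUnion (C : α → α → Bool) (l : List (List α)) (E : Finset α) : Prop :=
  (∀ a ∈ E, ∃ x ∈ l, a ∈ x) ∧ ∀ x ∈ l, IsMaxIndep C x.toFinset (E.filter (· ∈ x))

theorem filter_mem_left {x : List α} {E₁ E₂ : Finset α} (h₁ : E₁ ⊆ x.toFinset)
    (h₂ : ∀ a ∈ E₂, a ∉ x) : (E₂ ∪ E₁).filter (· ∈ x) = E₁ := by
  ext a
  have := @h₁ a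
  simp only [List.mem_toFinset] at this
  have := h₂ a
  simp only [Finset.mem_filter, Finset.mem_union]
  tauto

/-- The head is unranked with multiplier (product of the other counts) * m, so the number it hands
back lies in exactly the range that the tail expects. -/
theorem unrankProd_sound {l : List (List α)} (h : ∀ x ∈ l, Unranks C cnt unr x)
    (hd : l.Pairwise List.Disjoint) {m r : ℕ} (hr : r < (l.map cnt).prod * m) :
    (unrankProd cnt unr m l r).1.Nodup ∧
      IsMaxIndepUnion C l (unrankProd cnt unr m l r).1.toFinset ∧
      (unrankProd cnt unr m l r).2 < m := by
  induction l generalizing r with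
  | nil => simpa [unrankProd, IsMaxIndepUnion] using hr
  | cons x l ih =>
    obtain ⟨hxd, hd'⟩ := List.pairwise_cons.1 hd
    rw [List.map_cons, List.prod_cons, mul_assoc] at hr
    obtain ⟨h1, h2, h3⟩ := (h x (by simp)).sound _ _ hr
    obtain ⟨h4, h5, h6⟩ := ih (fun y hy => h y (by simp [hy])) hd' h3
    simp only [unrankProd]
    set u := unr x ((l.map cnt).prod * m) r
    set v := unrankProd cnt unr m l u.2
    have hux : ∀ a ∈ u.1, a ∈ x := fun a ha =>
      List.mem_toFinset.1 (h2.subset (List.mem_toFinset.2 ha))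
    have hvx : ∀ a ∈ v.1, a ∉ x := fun a ha hax => by
      obtain ⟨y, hy, hay⟩ := h5.1 a (List.mem_toFinset.2 ha)
      exact hxd y hy hax hay
    refine ⟨List.nodup_append'.2 ⟨h4, h1, fun a ha ha' => hvx a ha (hux a ha')⟩, ⟨?_, ?_⟩, h6⟩
    · intro a ha
      rw [List.mem_toFinset, List.mem_append] at ha
      rcases ha with ha | ha
      · obtain ⟨y, hy, hay⟩ := h5.1 a (List.mem_toFinset.2 ha)
        exact ⟨y, by simp [hy], hay⟩
      · exact ⟨x, by simp, hux a ha⟩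
    · intro y hy
      rw [List.toFinset_append]
      rcases List.mem_cons.1 hy with rfl | hy
      · rwa [filter_mem_left h2.subset fun a ha => hvx a (List.mem_toFinset.1 ha)]
      · convert h5.2 y hy using 1
        ext a
        have := hux a
        have := @hxd y hy a
        simp only [Finset.mem_filter, Finset.mem_union, List.mem_toFinset]
        tauto

theorem unrankProd_unique {l : List (List α)} (h : ∀ x ∈ l, Unranks C cnt unr x)
    (hd : l.Pairwise List.Disjoint) {m s : ℕ} {E : Finset α}
    (hE : IsMaxIndepUnion C l E) (hs : s < m) :
    ∃! r, r < (l.map cnt).prod * m ∧ (unrankProd cnt unr m l r).1.toFinset = E ∧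
      (unrankProd cnt unr m l r).2 = s := by
  induction l generalizing E with
  | nil =>
    have : E = ∅ := Finset.eq_empty_of_forall_notMem fun a ha => by simpa using hE.1 a ha
    subst this
    exact ⟨s, by simpa [unrankProd] using hs, by simp [unrankProd]⟩
  | cons x l ih =>
    obtain ⟨hxd, hd'⟩ := List.pairwise_cons.1 hd
    have hl : ∀ y ∈ l, Unranks C cnt unr y := fun y hy => h y (by simp [hy])
    have hx := h x (by simp)
    have hE' : IsMaxIndepUnion C l (E.filter (· ∉ x)) := by
      refine ⟨fun a ha => ?_, fun y hy => ?_⟩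
      · rw [Finset.mem_filter] at ha
        obtain ⟨y, hy, hay⟩ := hE.1 a ha.1
        rcases List.mem_cons.1 hy with rfl | hy
        · exact absurd hay ha.2
        · exact ⟨y, hy, hay⟩
      · convert hE.2 y (by simp [hy]) using 1
        ext a
        have := @hxd y hy a
        simp only [Finset.mem_filter]
        tauto
    -- Inversion runs backwards: the number r₂ that the tail needs is the one that the head must
    -- hand back.
    obtain ⟨r₂, ⟨hr₂, hr₂E, hr₂s⟩, hu₂⟩ := ih hl hd' hE'
    obtain ⟨r₁, ⟨hr₁, hr₁E, hr₁s⟩, hu₁⟩ := hx.unique _ _ _ (hE.2 x (by simp)) hr₂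
    rw [List.map_cons, List.prod_cons, mul_assoc]
    refine ⟨r₁, ⟨hr₁, ?_, ?_⟩, ?_⟩
    · simp only [unrankProd, hr₁s, List.toFinset_append, hr₂E, hr₁E]
      ext a
      simp only [Finset.mem_filter, Finset.mem_union]
      tauto
    · simp only [unrankProd, hr₁s, hr₂s]
    · rintro r ⟨hr, hrE, hrs⟩
      obtain ⟨-, h2, h3⟩ := hx.sound _ _ hr
      obtain ⟨-, h5, -⟩ := unrankProd_sound hl hd' h3
      simp only [unrankProd] at hrE hrs
      set u := unr x ((l.map cnt).prod * m) r
      set v := unrankProd cnt unr m l u.2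
      have hux : ∀ a ∈ u.1, a ∈ x := fun a ha =>
        List.mem_toFinset.1 (h2.subset (List.mem_toFinset.2 ha))
      have hvx : ∀ a ∈ v.1, a ∉ x := fun a ha hax => by
        obtain ⟨y, hy, hay⟩ := h5.1 a (List.mem_toFinset.2 ha)
        exact hxd y hy hax hay
      rw [List.toFinset_append] at hrE
      have e1 : u.1.toFinset = E.filter (· ∈ x) := by
        rw [← hrE, filter_mem_left h2.subset fun a ha => hvx a (List.mem_toFinset.1 ha)]
      have e2 : v.1.toFinset = E.filter (· ∉ x) := by
        rw [← hrE]
        ext a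
        have := hux a
        have := hvx a
        simp only [Finset.mem_filter, Finset.mem_union, List.mem_toFinset]
        tauto
      exact hu₁ r ⟨hr, e1, hu₂ _ ⟨h3, e2, hrs⟩⟩

/-! ### Joins, disjoint unions and their iteration. -/

variable {p q : α → α → Bool}

/-- Elements of different q-classes are always in conflict. So a nonempty independent set lies in
one class, and no element of another class can be added to it. An empty F is excluded because ∅
would be maximal there although no class exists. -/
theorem isMaxIndep_sum_iff (hq : IsBoolEquiv q) {F : List α} (hF : F ≠ []) {E : Finset α} :
    IsMaxIndep (fun a b => !q a b || C a b) F.toFinset E ↔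
      ∃ x ∈ F.classes q, IsMaxIndep C x.toFinset E := by
  constructor
  · intro h
    obtain ⟨a, ha⟩ := h.nonempty ((List.toFinset_nonempty_iff _).2 hF)
    obtain ⟨x, hx, hax⟩ := List.exists_mem_classes hq (List.mem_toFinset.1 (h.subset ha))
    have key : ∀ b ∈ E, b ∈ x := fun b hb => by
      have := h.indep a ha b hb
      simp only [Bool.or_eq_false_iff, Bool.not_eq_false'] at this
      exact List.mem_of_mem_classes_of_rel hq hx hax (List.mem_toFinset.1 (h.subset hb)) this.1
    refine ⟨x, hx, fun b hb => List.mem_toFinset.2 (key b hb), fun b hb c hc => ?_,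
      fun b hb hbE => ?_⟩
    · have := h.indep b hb c hc
      simp only [Bool.or_eq_false_iff] at this
      exact this.2
    · rw [List.mem_toFinset] at hb
      refine h.maximal b (List.mem_toFinset.2 ((List.sublist_of_mem_classes hx).subset hb))
        fun c hc => ?_
      simp [hbE c hc, List.rel_of_mem_classes hq hx hb (key c hc)]
  · rintro ⟨x, hx, h⟩
    have key : ∀ b ∈ E, b ∈ x := fun b hb => List.mem_toFinset.1 (h.subset hb)
    refine ⟨fun b hb => List.mem_toFinset.2 ((List.sublist_of_mem_classes hx).subset (key b hb)),
      fun b hb c hc => ?_, fun b hb hbE => ?_⟩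
    · simp [h.indep b hb c hc, List.rel_of_mem_classes hq hx (key b hb) (key c hc)]
    · obtain ⟨a, ha⟩ := h.nonempty
        ((List.toFinset_nonempty_iff _).2 (List.ne_nil_of_mem_classes hq hx))
      simp only [Bool.or_eq_false_iff, Bool.not_eq_false'] at hbE
      refine h.maximal b (List.mem_toFinset.2 ?_) fun c hc => (hbE c hc).2
      exact List.mem_of_mem_classes_of_rel hq hx (key a ha) (List.mem_toFinset.1 hb)
        (hq.symm _ _ (hbE a ha).1)

/-- There is no conflict across p-classes, so independence and maximality can both be checked class
by class. -/
theorem isMaxIndep_prod_iff (hp : IsBoolEquiv p) {F : List α} {E : Finset α} :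
    IsMaxIndep (fun a b => p a b && C a b) F.toFinset E ↔ IsMaxIndepUnion C (F.classes p) E := by
  constructor
  · intro h
    refine ⟨fun a ha => List.exists_mem_classes hp (List.mem_toFinset.1 (h.subset ha)),
      fun x hx => ⟨fun a ha => ?_, fun a ha b hb => ?_, fun a ha haE => ?_⟩⟩
    · exact List.mem_toFinset.2 (Finset.mem_filter.1 ha).2
    · rw [Finset.mem_filter] at ha hb
      have := h.indep a ha.1 b hb.1
      simpa [List.rel_of_mem_classes hp hx ha.2 hb.2] using this
    · rw [List.mem_toFinset] at ha
      refine Finset.mem_filter.2 ⟨h.maximal a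
        (List.mem_toFinset.2 ((List.sublist_of_mem_classes hx).subset ha)) fun b hb => ?_, ha⟩
      cases hab : p a b with
      | false => rfl
      | true =>
        exact haE b (Finset.mem_filter.2 ⟨hb, List.mem_of_mem_classes_of_rel hp hx ha
          (List.mem_toFinset.1 (h.subset hb)) hab⟩)
  · intro h
    have hsub : E ⊆ F.toFinset := fun a ha => by
      obtain ⟨x, hx, hax⟩ := h.1 a ha
      exact List.mem_toFinset.2 ((List.sublist_of_mem_classes hx).subset hax)
    refine ⟨hsub, fun a ha b hb => ?_, fun a ha haE => ?_⟩
    · cases hab : p a b with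
      | false => rfl
      | true =>
        obtain ⟨x, hx, hax⟩ := h.1 a ha
        exact (h.2 x hx).indep a (Finset.mem_filter.2 ⟨ha, hax⟩) b (Finset.mem_filter.2 ⟨hb,
          List.mem_of_mem_classes_of_rel hp hx hax (List.mem_toFinset.1 (hsub hb)) hab⟩)
    · obtain ⟨x, hx, hax⟩ := List.exists_mem_classes hp (List.mem_toFinset.1 ha)
      refine (Finset.mem_filter.1 ((h.2 x hx).maximal a (List.mem_toFinset.2 hax)
        fun b hb => ?_)).1
      rw [Finset.mem_filter] at hb
      have := haE b hb.1
      simpa [List.rel_of_mem_classes hp hx hax hb.2] using this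

theorem Unranks.sum (hq : IsBoolEquiv q) {F : List α} (hF : F ≠ [])
    (h : ∀ x ∈ F.classes q, Unranks C cnt unr x) :
    Unranks (fun a b => !q a b || C a b) (fun F => ((F.classes q).map cnt).sum)
      (fun F m r => unrankSum cnt unr m r (F.classes q)) F where
  pos := by
    obtain ⟨a, ha⟩ := List.exists_mem_of_ne_nil F hF
    obtain ⟨x, hx, -⟩ := List.exists_mem_classes hq ha
    exact (h x hx).pos.trans_le (List.single_le_sum (fun _ _ => Nat.zero_le _) _
      (List.mem_map_of_mem hx))
  sound m r hr := by
    have := unrankSum_sound h hr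
    rwa [← isMaxIndep_sum_iff hq hF] at this
  unique m E s hE hs := unrankSum_unique h (fun x hx => List.ne_nil_of_mem_classes hq hx)
    (List.pairwise_disjoint_classes hq F) ((isMaxIndep_sum_iff hq hF).1 hE) hs

theorem Unranks.prod (hp : IsBoolEquiv p) {F : List α}
    (h : ∀ x ∈ F.classes p, Unranks C cnt unr x) :
    Unranks (fun a b => p a b && C a b) (fun F => ((F.classes p).map cnt).prod)
      (fun F m r => unrankProd cnt unr m (F.classes p) r) F where
  pos := by
    refine List.prod_pos fun n hn => ?_
    obtain ⟨x, hx, rfl⟩ := List.mem_map.1 hn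
    exact (h x hx).pos
  sound m r hr := by
    have := unrankProd_sound h (List.pairwise_disjoint_classes hp F) hr
    rwa [← isMaxIndep_prod_iff hp] at this
  unique m E s hE hs := unrankProd_unique h
    (List.pairwise_disjoint_classes hp F) ((isMaxIndep_prod_iff hp).1 hE) hs

/-- The number of maximal independent sets for the conflict relation of a list of levels. -/
def levelCount {α : Type} : List ((α → α → Bool) × (α → α → Bool)) → List α → ℕ
  | [] => fun _ => 1
  | (p, q) :: L => fun F =>
    ((F.classes p).map fun B => ((B.classes q).map (levelCount L)).sum).prod

/-- Unranking of the maximal independent sets for the conflict relation of a list of levels. -/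
def levelUnrank {α : Type} :
    List ((α → α → Bool) × (α → α → Bool)) → List α → ℕ → ℕ → List α × ℕ
  | [] => fun F _ r => (F, r)
  | (p, q) :: L => fun F m r =>
    unrankProd (fun B => ((B.classes q).map (levelCount L)).sum)
      (fun B m r => unrankSum (levelCount L) (levelUnrank L) m r (B.classes q)) m (F.classes p) r

/-- The conflict relation of a list of levels `(p, q)`: there is no conflict between different
classes of the first `p`, and inside of these, elements of different classes of `q` are in conflict,
while the conflicts within the classes of `q` are those of the remaining levels. -/
def levelConflict {α : Type} : List ((α → α → Bool) × (α → α → Bool)) → α → α → Bool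
  | [] => fun _ _ => false
  | (p, q) :: L => fun a b => p a b && (!q a b || levelConflict L a b)

/-- Each level is a disjoint union of joins. Without levels there are no conflicts, F itself is the
only maximal independent set, and the number is passed on; `Nodup` is needed only there. -/
theorem levelUnrank_unranks {L : List ((α → α → Bool) × (α → α → Bool))}
    (hL : ∀ l ∈ L, IsBoolEquiv l.1 ∧ IsBoolEquiv l.2) {F : List α} (hF : F.Nodup) :
    Unranks (levelConflict L) (levelCount L) (levelUnrank L) F := by
  induction L generalizing F with
  | nil =>
    have key : ∀ E, IsMaxIndep (fun _ _ : α => false) F.toFinset E ↔ F.toFinset = E := by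
      intro E
      constructor
      · intro h
        exact Finset.Subset.antisymm (fun a ha => h.maximal a ha fun _ _ => rfl) h.subset
      · rintro rfl
        exact ⟨Finset.Subset.rfl, fun _ _ _ _ => rfl, fun a ha _ => ha⟩
    refine ⟨Nat.one_pos, fun m r hr => ⟨hF, (key _).2 rfl, ?_⟩, fun m E s hE hs => ?_⟩
    · simpa [levelCount, levelUnrank] using hr
    · refine ⟨s, ⟨?_, (key E).1 hE, rfl⟩, fun r hr => hr.2.2⟩
      simpa [levelCount] using hs
  | cons l L ih =>
    obtain ⟨p, q⟩ := l
    obtain ⟨hp, hq⟩ := hL _ (List.mem_cons_self)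
    refine Unranks.prod hp fun B hB => Unranks.sum hq (List.ne_nil_of_mem_classes hp hB)
      fun x hx => ih (fun l hl => hL l (List.mem_cons_of_mem _ hl)) ?_
    exact ((hF.sublist (List.sublist_of_mem_classes hB)).sublist (List.sublist_of_mem_classes hx))

/-- The nested relation sees a level only inside the classes of all earlier p; the hypothesis says
that every conflict of a later level lies there. An earlier q that fails only gives a conflict
sooner. -/
theorem levelConflict_eq_true_iff {α : Type} {L : List ((α → α → Bool) × (α → α → Bool))}
    (hL : L.Pairwise fun l l' => ∀ a b, l'.1 a b = true → l'.2 a b = false → l.1 a b = true)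
    (a b : α) :
    levelConflict L a b = true ↔ ∃ l ∈ L, l.1 a b = true ∧ l.2 a b = false := by
  induction L with
  | nil => simp [levelConflict]
  | cons l L ih =>
    obtain ⟨h1, h2⟩ := List.pairwise_cons.1 hL
    simp only [levelConflict, Bool.and_eq_true, Bool.or_eq_true, Bool.not_eq_true', ih h2,
      List.mem_cons, exists_eq_or_imp]
    constructor
    · tauto
    · rintro (h | ⟨l', hl', h3, h4⟩)
      · tauto
      · exact ⟨h1 l' hl' a b h3 h4, Or.inr ⟨l', hl', h3, h4⟩⟩

/-- For m = 1 the number handed back must be 0, so unranking becomes a bijection onto the sets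
alone. -/
theorem Unranks.card_eq {F : List α} (h : Unranks C cnt unr F) {M : Finset (Finset α)}
    (hM : ∀ E, E ∈ M ↔ IsMaxIndep C F.toFinset E) : M.card = cnt F := by
  rw [← Finset.card_range (cnt F)]
  symm
  refine Finset.card_bij (fun r _ => (unr F 1 r).1.toFinset) ?_ ?_ ?_
  · intro r hr
    exact (hM _).2 (h.sound 1 r (by simpa using hr)).2.1
  · intro r hr r' hr' heq
    have hs := h.sound 1 r (by simpa using hr)
    have hs' := h.sound 1 r' (by simpa using hr')
    exact (h.unique 1 _ 0 hs.2.1 Nat.one_pos).unique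
      ⟨by simpa using hr, rfl, by omega⟩ ⟨by simpa using hr', heq.symm, by omega⟩
  · intro E hE
    obtain ⟨r, ⟨h1, h2, -⟩, -⟩ := h.unique 1 E 0 ((hM E).1 hE) Nat.one_pos
    exact ⟨r, by simpa using h1, h2⟩

end

/-! ## Counting and unranking in polynomial time -/

/-- Carrying the offset of the current block along turns the recursion into a single fold. -/
theorem foldr_unrankSum {α : Type} {cnt : List α → ℕ} {unr : List α → ℕ → ℕ → List α × ℕ} 
    (m r : ℕ) (l : List (List α)) :
    l.foldr (fun x s => (bif decide (s.2 ≤ r) then unr x m (r - s.2) else s.1, cnt x * m + s.2))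
      (([], 0), 0) = (unrankSum cnt unr m r l, (l.map cnt).sum * m) := by
  induction l with
  | nil => simp [unrankSum]
  | cons x l ih => rw [List.foldr_cons, ih]; simp [unrankSum, Nat.add_mul]

/-- The radix at each member is the product over those still to come, which is why the recursion
needs access to the remaining list. -/
theorem para_unrankProd {α : Type} {cnt : List α → ℕ} {unr : List α → ℕ → ℕ → List α × ℕ} 
    (m r : ℕ) (acc : List α) (l : List (List α)) :
    l.para (fun s x l' => ((unr x ((l'.map cnt).prod * m) s.2).1 ++ s.1,
      (unr x ((l'.map cnt).prod * m) s.2).2)) (acc, r) =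
      ((unrankProd cnt unr m l r).1 ++ acc, (unrankProd cnt unr m l r).2) := by
  induction l generalizing r acc with
  | nil => simp [List.para, unrankProd]
  | cons x l ih => simp [List.para, ih, unrankProd]

section
variable {α δ : Type} [HasVal α] [HasVal δ]

theorem Polytime.reps {r : α → α → Bool} (hr : Polytime (fun y : α × α => r y.1 y.2))
    {l : δ → List α} (hl : Polytime l) : Polytime (fun d => (l d).reps r) := by
  have hr' : Polytime (fun y : (δ × List α × α × List α) × α => r y.1.2.2.1 y.2) :=
    hr.comp (g := fun y : (δ × List α × α × List α) × α => (y.1.2.2.1, y.2)) (by fun_prop)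
  have h := (Polytime.para
    (f := fun (_ : δ) (s : List α) x l' => bif l'.any (r x) then s else x :: s) (s := fun _ => [])
    (by fun_prop) ⟨Polynomial.X + 1, fun d s x l => by
      cases l.any (r x) <;> simp only [cond_true, cond_false, encSize_cons, Polynomial.eval_add,
        Polynomial.eval_X, Polynomial.eval_one] <;> omega⟩ (by fun_prop) hl).reverse
  convert h using 2 with d
  have : ∀ (l : List α) (s : List α),
      l.para (fun s x l' => bif l'.any (r x) then s else x :: s) s = (l.reps r).reverse ++ s := by
    intro l
    induction l with
    | nil => simp [List.para, List.reps]
    | cons x l ih =>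
      intro s
      cases hx : l.any (r x) <;> simp [List.para, List.reps, ih, hx, -List.any_eq_true,
        -List.any_eq_false]
  simp [this]

theorem Polytime.classes {r : α → α → Bool} (hr : Polytime (fun y : α × α => r y.1 y.2))
    {l : δ → List α} (hl : Polytime l) : Polytime (fun d => (l d).classes r) := by
  have h := Polytime.reps hr hl
  have hr' : Polytime (fun y : (δ × α) × α => r y.1.2 y.2) :=
    hr.comp (g := fun y : (δ × α) × α => (y.1.2, y.2)) (by fun_prop)
  unfold List.classes
  fun_prop

/-- The induction is over the program text: L is fixed, so the nesting of loops is bounded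
independently of the input. -/
theorem Polytime.levelCount {L : List ((α → α → Bool) × (α → α → Bool))}
    (hL : ∀ l ∈ L, Polytime (fun y : α × α => l.1 y.1 y.2) ∧ Polytime (fun y : α × α => l.2 y.1 y.2)) :
    Polytime (_root_.levelCount L) := by
  induction L with
  | nil => exact Polytime.const 1
  | cons l L ih =>
    obtain ⟨p, q⟩ := l
    obtain ⟨hp, hq⟩ := hL _ (List.mem_cons_self)
    have ih' := ih fun l hl => hL l (List.mem_cons_of_mem _ hl)
    have h1 : Polytime (fun y : List α × List α => y.2.classes q) := Polytime.classes hq (by fun_prop)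
    have h2 : Polytime (fun F : List α => F.classes p) := Polytime.classes hp (by fun_prop)
    have h3 : Polytime (fun y : List α × List α => ((y.2.classes q).map (_root_.levelCount L)).sum) :=
      (Polytime.map (ih'.comp Polytime.snd_aux) h1).sum
    exact (Polytime.map h3 h2).prod

/-! ### Unranking in polynomial time. -/

variable {cnt : List α → ℕ} {unr : List α → ℕ → ℕ → List α × ℕ}

/-- The outcomes of `unr` are small. -/
def SmallOutcomes (unr : List α → ℕ → ℕ → List α × ℕ) : Prop :=
  ∃ B : Polynomial ℕ, ∀ F m r, encSize (unr F m r).1 ≤ B.eval (encSize F) ∧ (unr F m r).2 ≤ r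

/-- The set comes from one member of the list; the extra 1 pays for the default outcome `[]`. The
bound is free of m and r, as the growth condition of the product needs. -/
theorem unrankSum_small {B : Polynomial ℕ}
    (hB : ∀ F m r, encSize (unr F m r).1 ≤ B.eval (encSize F) ∧ (unr F m r).2 ≤ r) (m r n : ℕ)
    {l : List (List α)} (hl : ∀ x ∈ l, encSize x ≤ n) :
    encSize (unrankSum cnt unr m r l).1 ≤ B.eval n + 1 ∧ (unrankSum cnt unr m r l).2 ≤ r := by
  induction l with
  | nil => simp [unrankSum, encSize_nil]
  | cons x l ih =>
    by_cases h : (l.map cnt).sum * m ≤ r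
    · simp only [unrankSum, h, decide_true, cond_true]
      have h1 := hB x m (r - (l.map cnt).sum * m)
      have h2 := B.eval_mono_nat (hl x (by simp))
      omega
    · simp only [unrankSum, h, decide_false, cond_false]
      exact ih fun y hy => hl y (by simp [hy])

theorem unrankProd_small {B : Polynomial ℕ}
    (hB : ∀ F m r, encSize (unr F m r).1 ≤ B.eval (encSize F) ∧ (unr F m r).2 ≤ r) (m r n : ℕ)
    {l : List (List α)} (hl : ∀ x ∈ l, encSize x ≤ n) :
    encSize (unrankProd cnt unr m l r).1 ≤ l.length * B.eval n + 1 ∧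
      (unrankProd cnt unr m l r).2 ≤ r := by
  induction l generalizing r with
  | nil => simp [unrankProd, encSize_nil]
  | cons x l ih =>
    simp only [unrankProd, List.length_cons, Nat.add_mul, Nat.one_mul]
    set u := unr x ((l.map cnt).prod * m) r
    have h1 := ih u.2 fun y hy => hl y (by simp [hy])
    have h2 : encSize u.1 ≤ B.eval (encSize x) ∧ u.2 ≤ r := hB _ _ _
    have h3 := B.eval_mono_nat (hl x (by simp))
    have h4 := encSize_append (unrankProd cnt unr m l u.2).1 u.1
    omega

theorem Polytime.unrankSum (hcnt : Polytime cnt)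
    (hunr : Polytime (fun y : List α × ℕ × ℕ => unr y.1 y.2.1 y.2.2)) (hsmall : SmallOutcomes unr)
    {m r : δ → ℕ} {l : δ → List (List α)} (hm : Polytime m) (hr : Polytime r) (hl : Polytime l) :
    Polytime (fun d => _root_.unrankSum cnt unr (m d) (r d) (l d)) := by
  obtain ⟨B, hB⟩ := hsmall
  obtain ⟨P, hP⟩ := hcnt.exists_size
  let step : ℕ × ℕ × List (List α) → (List α × ℕ) × ℕ → List α → (List α × ℕ) × ℕ := fun d s x =>
    (bif decide (s.2 ≤ d.2.1) then unr x d.1 (d.2.1 - s.2) else s.1, cnt x * d.1 + s.2)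
  have hstep : Polytime (fun y : (ℕ × ℕ × List (List α)) × ((List α × ℕ) × ℕ) × List α =>
      step y.1 y.2.1 y.2.2) := by
    have h1 : Polytime (fun y : (ℕ × ℕ × List (List α)) × ((List α × ℕ) × ℕ) × List α =>
        unr y.2.2 y.1.1 (y.1.2.1 - y.2.1.2)) :=
      hunr.comp (g := fun y : (ℕ × ℕ × List (List α)) × ((List α × ℕ) × ℕ) × List α =>
        (y.2.2, y.1.1, y.1.2.1 - y.2.1.2)) (by fun_prop)
    fun_prop
  have h := Polytime.foldl (f := step) (s := fun _ => (([], 0), 0)) (l := fun d => d.2.2.reverse)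
    -- B bounds a newly chosen set and P the count added to the offset; 2 * X covers m and r. The
    -- number handed back is at most r, which belongs to the parameter and not to the accumulator.
    hstep ⟨B + P + 2 * Polynomial.X + 3, fun d s x => by
      obtain ⟨m, r, l⟩ := d
      obtain ⟨⟨E, s⟩, T⟩ := s
      have h1 := hB x m (r - T)
      have h2 := hP x
      have h3 := encSize_nat_add (cnt x * m) T
      have h4 := encSize_nat_mul (cnt x) m
      have h5 := B.eval_mono_nat (Nat.le_add_left (encSize x) (encSize (m, r, l)))
      have h6 := P.eval_mono_nat (Nat.le_add_left (encSize x) (encSize (m, r, l)))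
      have h7 : encSize (unr x m (r - T)).2 ≤ encSize r :=
        encSize_nat_mono (h1.2.trans (Nat.sub_le _ _))
      simp only [step, Polynomial.eval_add, Polynomial.eval_mul, Polynomial.eval_X,
        Polynomial.eval_ofNat]
      generalize unr x m (r - T) = u at *
      obtain ⟨u, v⟩ := u
      cases decide (T ≤ r) <;> simp only [cond_true, cond_false, encSize_pair] at * <;> omega⟩
    (by fun_prop) (by fun_prop)
  have h' := (h.fst).comp (g := fun d => (m d, r d, l d)) (by fun_prop)
  simpa only [step, List.foldl_reverse, foldr_unrankSum] using h'

theorem Polytime.unrankProd (hcnt : Polytime cnt)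
    (hunr : Polytime (fun y : List α × ℕ × ℕ => unr y.1 y.2.1 y.2.2)) (hsmall : SmallOutcomes unr)
    {m r : δ → ℕ} {l : δ → List (List α)} (hm : Polytime m) (hr : Polytime r) (hl : Polytime l) :
    Polytime (fun d => _root_.unrankProd cnt unr (m d) (l d) (r d)) := by
  obtain ⟨B, hB⟩ := hsmall
  let step : δ → List α × ℕ → List α → List (List α) → List α × ℕ := fun d s x l' =>
    ((unr x ((l'.map cnt).prod * m d) s.2).1 ++ s.1, (unr x ((l'.map cnt).prod * m d) s.2).2)
  have hstep : Polytime (fun y : δ × (List α × ℕ) × List α × List (List α) =>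
      step y.1 y.2.1 y.2.2.1 y.2.2.2) := by
    have h1 : Polytime (fun y : δ × (List α × ℕ) × List α × List (List α) =>
        unr y.2.2.1 ((y.2.2.2.map cnt).prod * m y.1) y.2.1.2) :=
      hunr.comp (g := fun y : δ × (List α × ℕ) × List α × List (List α) =>
        (y.2.2.1, (y.2.2.2.map cnt).prod * m y.1, y.2.1.2)) (by fun_prop)
    fun_prop
  have h := Polytime.para (f := step) (s := fun d => ([], r d)) hstep
    ⟨B, fun d s x l' => by
      obtain ⟨E, s⟩ := s
      have h1 := hB x ((l'.map cnt).prod * m d) s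
      have h5 := B.eval_mono_nat (show encSize x ≤ encSize d + encSize x + encSize l' by omega)
      have h7 := encSize_nat_mono h1.2
      have h8 := encSize_append (unr x ((l'.map cnt).prod * m d) s).1 E
      simp only [step, encSize_pair]
      omega⟩ (by fun_prop) hl
  simpa only [step, para_unrankProd, List.append_nil] using h

theorem smallOutcomes_levelUnrank (L : List ((α → α → Bool) × (α → α → Bool))) :
    SmallOutcomes (levelUnrank L) := by
  induction L with
  | nil => exact ⟨Polynomial.X, fun F m r => by simp [levelUnrank]⟩
  | cons l L ih =>
    obtain ⟨p, q⟩ := l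
    obtain ⟨B, hB⟩ := ih
    -- X bounds the number of p-classes, B + 1 the outcome on each of them, and the last 1 the empty
    -- list.
    refine ⟨Polynomial.X * (B + 1) + 1, fun F m r => ?_⟩
    have key : ∀ (r : α → α → Bool) (F : List α), ∀ x ∈ F.classes r, encSize x ≤ encSize F :=
      fun r F x hx => encSize_le_of_sublist (List.sublist_of_mem_classes hx)
    have hsum : ∀ (F : List α) m r, encSize (unrankSum (levelCount L) (levelUnrank L) m r (F.classes q)).1 ≤
        (B + 1).eval (encSize F) ∧
        (unrankSum (levelCount L) (levelUnrank L) m r (F.classes q)).2 ≤ r := fun F m r => by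
      simpa using unrankSum_small hB m r _ (key q F)
    have h := unrankProd_small (cnt := fun B => ((B.classes q).map (levelCount L)).sum)
      hsum m r _ (key p F)
    refine ⟨h.1.trans ?_, h.2⟩
    have hlen : (F.classes p).length ≤ encSize F := by
      have h1 : ∀ l : List α, (l.reps p).length ≤ l.length := by
        intro l
        induction l with
        | nil => simp [List.reps]
        | cons x l ih =>
          unfold List.reps
          cases l.any (p x)
          · simpa using ih
          · simpa using ih.trans (Nat.le_succ _)
      unfold List.classes
      rw [List.length_map]
      exact (h1 F).trans (length_lt_encSize F).le
    simp only [Polynomial.eval_add, Polynomial.eval_mul, Polynomial.eval_X, Polynomial.eval_one]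
    gcongr

theorem Polytime.levelUnrank {L : List ((α → α → Bool) × (α → α → Bool))}
    (hL : ∀ l ∈ L, Polytime (fun y : α × α => l.1 y.1 y.2) ∧ Polytime (fun y : α × α => l.2 y.1 y.2)) :
    Polytime (fun y : List α × ℕ × ℕ => _root_.levelUnrank L y.1 y.2.1 y.2.2) := by
  induction L with
  | nil => exact Polytime.fst_aux.prodMk (by fun_prop)
  | cons l L ih =>
    have hL' := fun l hl => hL l (List.mem_cons_of_mem _ hl)
    have hcnt := Polytime.levelCount hL'
    have hsmall := smallOutcomes_levelUnrank L
    obtain ⟨p, q⟩ := l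
    obtain ⟨hp, hq⟩ := hL _ (List.mem_cons_self)
    have h1 : Polytime (fun B : List α => ((B.classes q).map (_root_.levelCount L)).sum) :=
      (Polytime.map (f := fun _ => _root_.levelCount L) (hcnt.comp Polytime.snd_aux)
        (Polytime.classes hq Polytime.id)).sum
    have h2 : Polytime (fun y : List α × ℕ × ℕ =>
        _root_.unrankSum (_root_.levelCount L) (_root_.levelUnrank L) y.2.1 y.2.2
          (y.1.classes q)) :=
      Polytime.unrankSum hcnt (ih hL') hsmall (by fun_prop) (by fun_prop)
        (Polytime.classes hq (by fun_prop))
    have h3 : SmallOutcomes (fun B m r =>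
        _root_.unrankSum (_root_.levelCount L) (_root_.levelUnrank L) m r (B.classes q)) := by
      obtain ⟨B, hB⟩ := hsmall
      refine ⟨B + 1, fun F m r => ?_⟩
      simpa using unrankSum_small hB m r (encSize F) fun x hx =>
        encSize_le_of_sublist (List.sublist_of_mem_classes hx)
    exact Polytime.unrankProd h1 h2 h3 (by fun_prop) (by fun_prop)
      (Polytime.classes hp (by fun_prop))

theorem Polytime.levelConflict {L : List ((α → α → Bool) × (α → α → Bool))}
    (hL : ∀ l ∈ L, Polytime (fun y : α × α => l.1 y.1 y.2) ∧ Polytime (fun y : α × α => l.2 y.1 y.2)) :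
    Polytime (fun y : α × α => _root_.levelConflict L y.1 y.2) := by
  induction L with
  | nil => exact Polytime.const false
  | cons l L ih =>
    obtain ⟨p, q⟩ := l
    obtain ⟨hp, hq⟩ := hL _ (List.mem_cons_self)
    exact hp.and (hq.not.or (ih fun l hl => hL l (List.mem_cons_of_mem _ hl)))

end

/-! ## Uniform sampling from a counted and unranked set -/

theorem Val.drawDist_succ (n : ℕ) : (Val.num (n + 1)).drawDist =
    (PMF.uniformOfFintype (Fin (n + 1))).bind fun k => PMF.pure (Val.num (k : ℕ)) := by
  change ((PMF.uniformOfFintype (Fin (n + 1))).bind fun k => PMF.pure (k : ℕ)).bind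
    (fun k => PMF.pure (Val.num k)) = _
  simp only [PMF.bind_bind, PMF.pure_bind]

/-- The only draw is made below the computed count while the input is kept beside it. An outcome k ≤
n is encoded no longer than n + 1, so the time bound holds for every outcome. -/
theorem Polytime.exists_run_draw {α β : Type} [HasVal α] [HasVal β] {f : α × ℕ → β} {cnt : α → ℕ}
    (hf : Polytime f) (hcnt : Polytime cnt) :
    ∃ (P : Prog) (pol : Polynomial ℕ), ∀ a n, cnt a = n + 1 →
      P.Run (enc a) (((PMF.uniformOfFintype (Fin (n + 1))).map fun k : Fin (n + 1) => f (a, (k : ℕ))).map enc)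
        (pol.eval (encSize a)) := by
  obtain ⟨p, P, -, hP⟩ := Polytime.id.prodMk hcnt
  obtain ⟨q, Q, -, hQ⟩ := hf
  refine ⟨.seq p (.seq (.pair (.op .fst) (.seq (.op .snd) .draw)) q),
    Polynomial.X + 7 * P + Q.comp P, fun a n hn => ?_⟩
  obtain ⟨h1, h2⟩ := hP a
  simp only [hn] at h1 h2
  -- Only pairs with a number as second component are in the support; the other case is arbitrary.
  let ν : Val → PMF Val := fun w => match w with
    | .pair _ (.num k) => PMF.pure (enc (f (a, k)))
    | _ => PMF.pure (.num 0)
  have hdraw : (Prog.seq (.op .snd) .draw).Run (enc (a, n + 1)) (Val.num (n + 1)).drawDist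
      ((enc (a, n + 1)).size + (enc (a, n + 1)).size + (Val.num (n + 1)).size) := by
    have := Prog.Run.seq (q := .draw) (ν := Val.drawDist) (t := (Val.num (n + 1)).size)
      (Prog.Run.op .snd (enc (a, n + 1))) (by
        intro w hw
        obtain rfl : w = Val.num (n + 1) := (PMF.mem_support_pure_iff _ _).1 hw
        exact Prog.Run.draw _)
    rw [PMF.pure_bind] at this
    exact this
  have hpair := Prog.Run.pair (Prog.Run.op .fst (enc (a, n + 1))) hdraw
  have hsize : ∀ k, k ≤ n → encSize (a, k) ≤ encSize (a, n + 1) := by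
    intro k hk
    have : encSize k ≤ encSize (n + 1) := encSize_nat_mono (by omega)
    simp only [encSize_pair]
    omega
  have hfin := Prog.Run.seq (q := q) (ν := ν) (t := Q.eval (P.eval (encSize a))) hpair (by
    intro w hw
    simp only [Val.drawDist_succ, PMF.pure_bind, PMF.mem_support_bind_iff,
      PMF.mem_support_pure_iff] at hw
    obtain ⟨w', ⟨k, -, rfl⟩, rfl⟩ := hw
    have hk := k.2
    refine ((hQ (a, (k : ℕ))).1).mono (Q.eval_mono_nat ((hsize k (by omega)).trans h2)))
  have hall := Prog.Run.seq (ν := fun _ => _) h1 (by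
    intro w hw
    obtain rfl : w = enc (a, n + 1) := by simpa using hw
    exact hfin)
  rw [PMF.pure_bind] at hall
  have hdist : (((PMF.pure (Op.fst.apply (enc (a, n + 1)))).bind fun a' =>
      (Val.num (n + 1)).drawDist.bind fun b => PMF.pure (.pair a' b)).bind ν) =
      ((PMF.uniformOfFintype (Fin (n + 1))).map fun k : Fin (n + 1) => f (a, (k : ℕ))).map enc := by
    simp only [Val.drawDist_succ, PMF.pure_bind, PMF.bind_bind, PMF.map, Function.comp_def, ν]
  rw [hdist] at hall
  refine hall.mono ?_
  have e1 : (enc (a, n + 1)).size = encSize (a, n + 1) := rfl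
  have e2 : (Val.num (n + 1)).size ≤ encSize (a, n + 1) := by
    rw [encSize_pair]
    have : (Val.num (n + 1)).size = encSize (n + 1) := rfl
    omega
  have e3 : (enc a).size = encSize a := rfl
  simp only [Polynomial.eval_add, Polynomial.eval_X, Polynomial.eval_mul, Polynomial.eval_ofNat,
    Polynomial.eval_comp]
  omega

/-- Each set in M is hit by exactly one of the n + 1 equally likely numbers, and n + 1 is the size
of M. -/
theorem Unranks.map_uniform {α : Type} [DecidableEq α] {C : α → α → Bool} {cnt : List α → ℕ}
    {unr : List α → ℕ → ℕ → List α × ℕ} {F : List α} (h : Unranks C cnt unr F)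
    {M : Finset (Finset α)} (hM : ∀ E, E ∈ M ↔ IsMaxIndep C F.toFinset E) (hne : M.Nonempty)
    {n : ℕ} (hn : cnt F = n + 1) :
    ((PMF.uniformOfFintype (Fin (n + 1))).map fun k : Fin (n + 1) => (unr F 1 (k : ℕ)).1).map List.toFinset =
      PMF.uniformOfFinset M hne := by
  have hcard := h.card_eq hM
  ext E
  rw [PMF.map_comp, PMF.map_apply, tsum_fintype, PMF.uniformOfFinset_apply]
  simp only [PMF.uniformOfFintype_apply, Fintype.card_fin, Function.comp_apply]
  split_ifs with hE
  · obtain ⟨r, ⟨h1, h2, h3⟩, hu⟩ := h.unique 1 E 0 ((hM E).1 hE) Nat.one_pos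
    rw [mul_one, hn] at h1
    rw [Finset.sum_eq_single ⟨r, h1⟩, if_pos h2.symm, hcard, hn]
    · intro k _ hk
      refine if_neg fun hEk => hk (Fin.ext ?_)
      have := (h.sound 1 k (by rw [mul_one, hn]; exact k.2)).2.2
      exact hu k ⟨by rw [mul_one, hn]; exact k.2, hEk.symm, by omega⟩
    · simp
  · refine Finset.sum_eq_zero fun k _ => if_neg fun hEk => hE ?_
    rw [hM, hEk]
    exact (h.sound 1 k (by rw [mul_one, hn]; exact k.2)).2.1

/-! ## Functional dependencies -/

section
variable {S : Schema}

/-- Two facts have the same relation name, and agree on `X` if this is `R`. -/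
noncomputable def agreeOn (R : Fin S.numRel) (X : Finset (Fin (S.arity R))) (f g : DBFact S) : Bool :=
  decide ((f.1 : ℕ) = g.1) &&
    (!decide ((f.1 : ℕ) = R) || X.toList.all fun i => decide (f.get i = g.get i))

theorem agreeOn_iff {R : Fin S.numRel} {X : Finset (Fin (S.arity R))} {f g : DBFact S} :
    agreeOn R X f g = true ↔ f.1 = g.1 ∧ (f.1 = R → ∀ i ∈ X, f.get i = g.get i) := by
  simp only [agreeOn, Bool.and_eq_true, decide_eq_true_eq, Bool.or_eq_true, Bool.not_eq_true',
    decide_eq_false_iff_not, List.all_eq_true, Finset.mem_toList, Fin.val_inj,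
    imp_iff_not_or (a := f.1 = R)]

theorem isBoolEquiv_agreeOn (R : Fin S.numRel) (X : Finset (Fin (S.arity R))) :
    IsBoolEquiv (agreeOn R X) where
  refl f := agreeOn_iff.2 ⟨rfl, fun _ _ _ => rfl⟩
  symm f g h := by
    rw [agreeOn_iff] at *
    exact ⟨h.1.symm, fun hR i hi => (h.2 (h.1.trans hR) i hi).symm⟩
  trans f g k h h' := by
    rw [agreeOn_iff] at *
    exact ⟨h.1.trans h'.1, fun hR i hi => (h.2 hR i hi).trans (h'.2 (h.1.symm.trans hR) i hi)⟩

theorem polytime_agreeOn (R : Fin S.numRel) (X : Finset (Fin (S.arity R))) :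
    Polytime (fun y : DBFact S × DBFact S => agreeOn R X y.1 y.2) := by
  have h1 := Polytime.rel (g := fun y : DBFact S × DBFact S => y.1) (by fun_prop)
  have h2 := Polytime.rel (g := fun y : DBFact S × DBFact S => y.2) (by fun_prop)
  have h3 := Polytime.forall_mem_list (δ := DBFact S × DBFact S)
    (f := fun (i : Fin (S.arity R)) y => decide (y.1.get i = y.2.get i))
    (fun i => (Polytime.get (by fun_prop) i).natEq (Polytime.get (by fun_prop) i)) X.toList
  unfold agreeOn
  fun_prop

theorem DBFact.get_mk {R : Fin S.numRel} (a : Fin (S.arity R) → ℕ) (i : Fin (S.arity R)) :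
    DBFact.get (⟨R, a⟩ : DBFact S) i = a i := by
  simp [DBFact.get, List.getD]

/-- For a fixed schema this reduces equality of facts to finitely many fixed polynomial-time tests.
-/
theorem DBFact.eq_iff {f g : DBFact S} :
    f = g ↔ ∀ R, agreeOn R Finset.univ f g = true := by
  constructor
  · rintro rfl R
    exact (isBoolEquiv_agreeOn R _).refl f
  · intro h
    obtain ⟨R, a⟩ := f
    obtain ⟨R', b⟩ := g
    have := agreeOn_iff.1 (h R)
    obtain rfl : R = R' := this.1
    congr
    funext i
    have := this.2 rfl i (Finset.mem_univ _)
    rwa [DBFact.get_mk, DBFact.get_mk] at this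

theorem Polytime.factEq {δ : Type} [HasVal δ] {f g : δ → DBFact S} (hf : Polytime f)
    (hg : Polytime g) : Polytime (fun d => decide (f d = g d)) := by
  have h := Polytime.forall_mem_list (δ := DBFact S × DBFact S)
    (f := fun (R : Fin S.numRel) y => agreeOn R Finset.univ y.1 y.2)
    (fun R => polytime_agreeOn R _) Finset.univ.toList
  convert h.comp (hf.prodMk hg) using 2 with d
  rw [Bool.eq_iff_iff, decide_eq_true_eq, DBFact.eq_iff]
  simp

/-- The level of a functional dependency. -/
noncomputable def FD.level (φ : FD S) :
    (DBFact S → DBFact S → Bool) × (DBFact S → DBFact S → Bool) :=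
  (agreeOn φ.rel φ.lhs, agreeOn φ.rel φ.rhs)

/-- Facts of a relation other than `φ.rel` agree in both components of the level as soon as their
relation names agree, so a violation can only come from `φ.rel`. This lets dependencies of all
relations share one list of levels. -/
theorem FD.holds_iff {φ : FD S} {D : DB S} :
    φ.Holds D ↔ ∀ f ∈ D, ∀ g ∈ D, ¬ (φ.level.1 f g = true ∧ φ.level.2 f g = false) := by
  constructor
  · rintro h ⟨R, a⟩ hf ⟨R', b⟩ hg ⟨h1, h2⟩
    rw [← Bool.not_eq_true, FD.level, agreeOn_iff] at h2
    rw [FD.level, agreeOn_iff] at h1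
    obtain rfl : R = R' := h1.1
    refine h2 ⟨rfl, fun hR i hi => ?_⟩
    obtain rfl : R = φ.rel := hR
    have h3 := h1.2 rfl
    simp only [DBFact.get_mk] at h3 ⊢
    exact h a b hf hg h3 i hi
  · intro h a b ha hb hab A hA
    have h1 := h _ ha _ hb
    rw [← Bool.not_eq_true, FD.level, agreeOn_iff, agreeOn_iff, not_and, not_not] at h1
    have := (h1 ⟨rfl, fun _ i hi => by rw [DBFact.get_mk, DBFact.get_mk]; exact hab i hi⟩).2 rfl A hA
    rwa [DBFact.get_mk, DBFact.get_mk] at this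

/-- Sort by the cardinality of the left-hand sides: within one relation, comparability then gives
inclusion. Across relations, a violation of ψ places both facts in `ψ.rel`, where the left-hand side
of any φ on another relation imposes nothing. -/
theorem HasLHSChain.exists_list {Sig : Finset (FD S)} (h : HasLHSChain Sig) :
    ∃ L : List (FD S), (∀ φ, φ ∈ L ↔ φ ∈ Sig) ∧
      L.Pairwise fun φ ψ => ∀ f g, ψ.level.1 f g = true → ψ.level.2 f g = false →
        φ.level.1 f g = true := by
  let r : FD S → FD S → Prop := fun φ ψ => φ.lhs.card ≤ ψ.lhs.card
  classical
  have : Std.Total r := ⟨fun φ ψ => Nat.le_total _ _⟩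
  have : IsTrans (FD S) r := ⟨fun φ ψ χ => Nat.le_trans⟩
  have hmem : ∀ φ, φ ∈ Sig.toList.insertionSort r ↔ φ ∈ Sig := by simp
  refine ⟨Sig.toList.insertionSort r, hmem, ?_⟩
  refine List.Pairwise.imp_of_mem ?_ (List.pairwise_insertionSort r Sig.toList)
  rintro ⟨R, X, Y⟩ ⟨R', X', Y'⟩ hφ hψ hr f g h1 h2
  rw [← Bool.not_eq_true] at h2
  simp only [FD.level, agreeOn_iff] at h1 h2 ⊢
  refine ⟨h1.1, fun hR i hi => ?_⟩
  have hR' : f.1 = R' := by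
    by_contra hne
    exact h2 ⟨h1.1, fun h => absurd h hne⟩
  obtain rfl : R = R' := hR.symm.trans hR'
  have hXX' : X ⊆ X' := by
    rcases h R X Y X' Y' ((hmem _).1 hφ) ((hmem _).1 hψ) with h | h
    · exact h
    · exact (Finset.eq_of_subset_of_card_le h hr).ge
  exact h1.2 hR i (hXX' hi)

/-- The conflicts between facts for a list of functional dependencies. -/
noncomputable def fdConflict (L : List (FD S)) : DBFact S → DBFact S → Bool :=
  levelConflict (L.map FD.level)

theorem exists_conflict (Sig : Finset (FD S)) (h : HasLHSChain Sig) :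
    ∃ L : List (FD S), (∀ f g, fdConflict L f g = true ↔
      ∃ φ ∈ Sig, φ.level.1 f g = true ∧ φ.level.2 f g = false) := by
  obtain ⟨L, hL, hp⟩ := h.exists_list
  refine ⟨L, fun f g => ?_⟩
  rw [fdConflict, levelConflict_eq_true_iff (List.pairwise_map.2 hp)]
  simp [hL]

end

/-! ### Repairs as maximal independent sets. -/

section
variable {S : Schema}

theorem consistent_iff {Sig : Finset (FD S)} {L : List (FD S)}
    (hL : ∀ f g, fdConflict L f g = true ↔ ∃ φ ∈ Sig, φ.level.1 f g = true ∧ φ.level.2 f g = false)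
    {D : DB S} : Consistent Sig D ↔ ∀ f ∈ D, ∀ g ∈ D, fdConflict L f g = false := by
  simp only [Consistent, FD.holds_iff, ← Bool.not_eq_true, hL]
  push Not
  exact ⟨fun h f hf g hg φ hφ => h φ hφ f hf g hg, fun h φ hφ f hf g hg => h f hf g hg φ hφ⟩

theorem fdConflict_self {Sig : Finset (FD S)} {L : List (FD S)}
    (hL : ∀ f g, fdConflict L f g = true ↔ ∃ φ ∈ Sig, φ.level.1 f g = true ∧ φ.level.2 f g = false)
    (f : DBFact S) : fdConflict L f f = false := by
  rw [← Bool.not_eq_true, hL]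
  rintro ⟨φ, -, -, h⟩
  simp [FD.level, (isBoolEquiv_agreeOn φ.rel φ.rhs).refl f] at h

theorem fdConflict_symm {Sig : Finset (FD S)} {L : List (FD S)}
    (hL : ∀ f g, fdConflict L f g = true ↔ ∃ φ ∈ Sig, φ.level.1 f g = true ∧ φ.level.2 f g = false)
    (f g : DBFact S) : fdConflict L f g = fdConflict L g f := by
  have key : ∀ f g, fdConflict L f g = true → fdConflict L g f = true := by
    intro f g h
    rw [hL] at h ⊢
    obtain ⟨φ, hφ, h1, h2⟩ := h
    refine ⟨φ, hφ, (isBoolEquiv_agreeOn _ _).symm _ _ h1, ?_⟩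
    rw [← Bool.not_eq_true] at h2 ⊢
    exact fun h => h2 ((isBoolEquiv_agreeOn _ _).symm _ _ h)
  rw [Bool.eq_iff_iff]
  exact ⟨key f g, key g f⟩

/-- Consistency passes to subsets, so maximality need only be tested by adding single facts.
Symmetry and the absence of self-conflicts make such an enlarged set independent. -/
theorem mem_repairs_iff {Sig : Finset (FD S)} {L : List (FD S)}
    (hL : ∀ f g, fdConflict L f g = true ↔ ∃ φ ∈ Sig, φ.level.1 f g = true ∧ φ.level.2 f g = false)
    {D E : DB S} : E ∈ repairs Sig D ↔ IsMaxIndep (fdConflict L) D E := by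
  simp only [repairs, Finset.mem_filter, Finset.mem_powerset, consistent_iff hL]
  constructor
  · rintro ⟨h1, ⟨-, h2⟩, h3⟩
    refine ⟨h1, h2, fun f hf hfE => ?_⟩
    refine h3 (y := insert f E) ⟨Finset.insert_subset hf h1, fun a ha b hb => ?_⟩
      (Finset.subset_insert _ _) (Finset.mem_insert_self _ _)
    rcases Finset.mem_insert.1 ha with ha' | ha' <;> rcases Finset.mem_insert.1 hb with hb' | hb'
    · rw [ha', hb']; exact fdConflict_self hL _
    · rw [ha']; exact hfE b hb'
    · rw [hb', fdConflict_symm hL]; exact hfE a ha'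
    · exact h2 a ha' b hb'
  · intro h
    refine ⟨h.subset, ⟨h.subset, h.indep⟩, fun E' hE' hEE' f hf => ?_⟩
    exact h.maximal f (hE'.1 hf) fun g hg => hE'.2 f hf g (hEE' hg)

theorem entailedBy_ofFacts_iff {H E : DB S} : (CQ.ofFacts H).EntailedBy E ↔ H ⊆ E := by
  have key : ∀ h, (CQ.ofFacts H).image h = H := by
    intro h
    rw [CQ.image, CQ.ofFacts, Finset.image_image]
    exact Finset.image_id
  simp only [CQ.EntailedBy, CQ.IsHom, key, exists_const]

/-- The facts of `lD` that are in conflict with no fact of `lH`. -/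
noncomputable def compatibleFacts (L : List (FD S)) (lD lH : List (DBFact S)) : List (DBFact S) :=
  lD.filter fun f => lH.all fun g => !fdConflict L f g

/-- A repair containing H has only compatible facts. Conversely, the facts of H are compatible
because H is consistent, and they conflict with no compatible fact, so maximality forces them in;
they then exclude every incompatible fact of D. -/
theorem mem_repairsEntailing_iff {Sig : Finset (FD S)} {L : List (FD S)}
    (hL : ∀ f g, fdConflict L f g = true ↔ ∃ φ ∈ Sig, φ.level.1 f g = true ∧ φ.level.2 f g = false)
    {lD lH : List (DBFact S)} (hHD : lH ⊆ lD) (hH : Consistent Sig lH.toFinset) {E : DB S} :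
    E ∈ repairsEntailing Sig lD.toFinset (CQ.ofFacts lH.toFinset) ↔
      IsMaxIndep (fdConflict L) (compatibleFacts L lD lH).toFinset E := by
  simp only [repairsEntailing, Finset.mem_filter, mem_repairs_iff hL, entailedBy_ofFacts_iff]
  have hmem : ∀ f, f ∈ (compatibleFacts L lD lH).toFinset ↔
      f ∈ lD ∧ ∀ g ∈ lH, fdConflict L f g = false := by
    simp [compatibleFacts]
  rw [consistent_iff hL] at hH
  simp only [List.mem_toFinset] at hH
  constructor
  · rintro ⟨h1, h2⟩
    refine ⟨fun f hf => (hmem f).2 ⟨List.mem_toFinset.1 (h1.subset hf), fun g hg =>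
      h1.indep f hf g (h2 (List.mem_toFinset.2 hg))⟩, h1.indep, fun f hf hfE => ?_⟩
    exact h1.maximal f (List.mem_toFinset.2 ((hmem f).1 hf).1) hfE
  · intro h
    have hHE : ∀ f ∈ lH, f ∈ E := fun f hf =>
      h.maximal f ((hmem f).2 ⟨hHD hf, fun g hg => hH f hf g hg⟩) fun g hg => by
        rw [fdConflict_symm hL]
        exact ((hmem g).1 (h.subset hg)).2 f hf
    refine ⟨⟨fun f hf => List.mem_toFinset.2 ((hmem f).1 (h.subset hf)).1, h.indep,
      fun f hf hfE => ?_⟩, fun f hf => hHE f (List.mem_toFinset.1 hf)⟩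
    exact h.maximal f ((hmem f).2 ⟨List.mem_toFinset.1 hf, fun g hg => hfE g (hHE g hg)⟩) hfE

theorem polytime_levels (L : List (FD S)) :
    ∀ l ∈ L.map FD.level, Polytime (fun y : DBFact S × DBFact S => l.1 y.1 y.2) ∧
      Polytime (fun y : DBFact S × DBFact S => l.2 y.1 y.2) := by
  intro l hl
  obtain ⟨φ, -, rfl⟩ := List.mem_map.1 hl
  exact ⟨polytime_agreeOn _ _, polytime_agreeOn _ _⟩

theorem isBoolEquiv_levels (L : List (FD S)) :
    ∀ l ∈ L.map FD.level, IsBoolEquiv l.1 ∧ IsBoolEquiv l.2 := by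
  intro l hl
  obtain ⟨φ, -, rfl⟩ := List.mem_map.1 hl
  exact ⟨isBoolEquiv_agreeOn _ _, isBoolEquiv_agreeOn _ _⟩

theorem Polytime.fdConflict {δ : Type} [HasVal δ] (L : List (FD S)) {f g : δ → DBFact S}
    (hf : Polytime f) (hg : Polytime g) : Polytime (fun d => _root_.fdConflict L (f d) (g d)) :=
  (Polytime.levelConflict (polytime_levels L)).comp (hf.prodMk hg)

theorem polytime_compatibleFacts (L : List (FD S)) :
    Polytime (fun y : List (DBFact S) × List (DBFact S) => compatibleFacts L y.1 y.2) := by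
  have h : Polytime (fun y : ((List (DBFact S) × List (DBFact S)) × DBFact S) × DBFact S =>
      _root_.fdConflict L y.1.2 y.2) := Polytime.fdConflict L (by fun_prop) (by fun_prop)
  unfold compatibleFacts
  fun_prop

/-- The test whether `l` is a maximal subset of `lD` without conflicts that contains `lH`. -/
noncomputable def isRepairTest (L : List (FD S)) (lD lH l : List (DBFact S)) : Bool :=
  (l.all fun f => lD.any fun g => decide (f = g)) &&
    (lH.all fun f => l.any fun g => decide (f = g)) &&
    (l.all fun f => l.all fun g => !fdConflict L f g) &&
    (lD.all fun f => (l.any fun g => decide (f = g)) || l.any fun g => fdConflict L f g)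

theorem polytime_isRepairTest (L : List (FD S)) :
    Polytime (fun y : (List (DBFact S) × List (DBFact S)) × List (DBFact S) =>
      isRepairTest L y.1.1 y.1.2 y.2) := by
  have h : Polytime (fun y : (((List (DBFact S) × List (DBFact S)) × List (DBFact S)) × DBFact S) ×
      DBFact S => _root_.fdConflict L y.1.2 y.2) := Polytime.fdConflict L (by fun_prop) (by fun_prop)
  have h' : Polytime (fun y : (((List (DBFact S) × List (DBFact S)) × List (DBFact S)) × DBFact S) ×
      DBFact S => decide (y.1.2 = y.2)) := Polytime.factEq (by fun_prop) (by fun_prop)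
  unfold isRepairTest
  fun_prop

theorem isRepairTest_iff {Sig : Finset (FD S)} {L : List (FD S)}
    (hL : ∀ f g, fdConflict L f g = true ↔ ∃ φ ∈ Sig, φ.level.1 f g = true ∧ φ.level.2 f g = false)
    {lD lH l : List (DBFact S)} : isRepairTest L lD lH l = true ↔
      l.toFinset ∈ repairsEntailing Sig lD.toFinset (CQ.ofFacts lH.toFinset) := by
  simp only [repairsEntailing, Finset.mem_filter, mem_repairs_iff hL, entailedBy_ofFacts_iff]
  simp only [isRepairTest, Bool.and_eq_true, Bool.or_eq_true, List.all_eq_true, List.any_eq_true,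
    Bool.not_eq_true', decide_eq_true_eq, exists_eq_right']
  constructor
  · rintro ⟨⟨⟨h1, h2⟩, h3⟩, h4⟩
    refine ⟨⟨fun f hf => ?_, fun f hf g hg => ?_, fun f hf hfE => ?_⟩, fun f hf => ?_⟩
    · simpa using h1 f (by simpa using hf)
    · exact h3 f (by simpa using hf) g (by simpa using hg)
    · rcases h4 f (by simpa using hf) with h | ⟨g, hg, hfg⟩
      · simpa using h
      · rw [hfE g (by simpa using hg)] at hfg
        simp at hfg
    · simpa using h2 f (by simpa using hf)
  · rintro ⟨h, hH⟩
    refine ⟨⟨⟨fun f hf => ?_, fun f hf => ?_⟩, fun f hf g hg => ?_⟩, fun f hf => ?_⟩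
    · simpa using h.subset (by simpa using hf)
    · simpa using hH (by simpa using hf)
    · exact h.indep f (by simpa using hf) g (by simpa using hg)
    · by_contra hcon
      push Not at hcon
      refine hcon.1 (List.mem_toFinset.1 (h.maximal f (by simpa using hf) fun g hg => ?_))
      simpa using hcon.2 g (by simpa using hg)

theorem FDEquiv.repairsEntailing_eq {Sig Sig' : Finset (FD S)} (h : FDEquiv Sig Sig') (D : DB S)
    (Q : CQ S) : repairsEntailing Sig D Q = repairsEntailing Sig' D Q := by
  have : Consistent Sig = Consistent Sig' := funext fun D => propext (h D)
  ext E
  simp only [repairsEntailing, repairs, Finset.mem_filter, this]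

theorem subset_of_mem_homImages {Sig : Finset (FD S)} {Q : CQ S} {D H : DB S}
    (h : H ∈ homImages Sig Q D) : H ⊆ D ∧ Consistent Sig H := by
  obtain ⟨f, h1, h2, rfl⟩ := h
  exact ⟨h1, h2⟩

theorem DB.norm_mono {D D' : DB S} (h : D ⊆ D') : DB.norm D ≤ DB.norm D' := by
  unfold DB.norm
  gcongr

end

/-! ### The three algorithms. -/

theorem mainTheorem8 (S : Schema) (Sig : Finset (FD S)) (hSig : HasLHSChainUpToEquiv Sig)
    (Q : CQ S) :
    -- (1) counting
    (∃ (P : Prog) (pol : Polynomial ℕ), P.Deterministic ∧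
      ∀ (D H : DB S), H ∈ homImages Sig Q D →
      ∀ (lD lH : List (DBFact S)), Enumerates lD D → Enumerates lH H →
        P.Run (.pair (encodeFacts lD) (encodeFacts lH))
          (PMF.pure (.num (repairsEntailing Sig D (CQ.ofFacts H)).card))
          (pol.eval (DB.norm D))) ∧
    -- (2) uniform sampling
    (∃ (P : Prog) (pol : Polynomial ℕ),
      ∀ (D H : DB S), H ∈ homImages Sig Q D →
      ∃ hne : (repairsEntailing Sig D (CQ.ofFacts H)).Nonempty,
      ∀ (lD lH : List (DBFact S)), Enumerates lD D → Enumerates lH H →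
        ∃ out : PMF (List (DBFact S)),
          (∀ l ∈ out.support, l.Nodup) ∧
          out.map List.toFinset = PMF.uniformOfFinset (repairsEntailing Sig D (CQ.ofFacts H)) hne ∧
          P.Run (.pair (encodeFacts lD) (encodeFacts lH)) (out.map encodeFacts)
            (pol.eval (DB.norm D))) ∧
    -- (3) membership
    (∃ (P : Prog) (pol : Polynomial ℕ), P.Deterministic ∧
      ∀ (D H : DB S), H ∈ homImages Sig Q D → ∀ D' : DB S,
      ∀ (lD lH lD' : List (DBFact S)), Enumerates lD D → Enumerates lH H → Enumerates lD' D' →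
        ∃ t : ℕ,
          P.Run (.pair (.pair (encodeFacts lD) (encodeFacts lH)) (encodeFacts lD'))
            (PMF.pure (.num (if D' ∈ repairsEntailing Sig D (CQ.ofFacts H) then 1 else 0))) t ∧
          t ≤ pol.eval (DB.norm D + DB.norm D') ∧
          (D' ⊆ D → t ≤ pol.eval (DB.norm D))) := by
  obtain ⟨Sig', hequiv, hchain⟩ := hSig
  obtain ⟨L, hL⟩ := exists_conflict Sig' hchain
  have hH' : ∀ {D H : DB S}, H ∈ homImages Sig Q D → H ⊆ D ∧ Consistent Sig' H := fun h =>
    ⟨(subset_of_mem_homImages h).1, (hequiv _).1 (subset_of_mem_homImages h).2⟩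
  simp only [hequiv.repairsEntailing_eq]
  -- As H ⊆ D, the input pair has size at most twice ‖D‖ plus its pair node, so bounds in ‖D‖ alone
  -- suffice.
  have hsize : ∀ {D H : DB S} {lD lH : List (DBFact S)}, H ⊆ D → Enumerates lD D →
      Enumerates lH H → encSize (lD, lH) ≤ 2 * DB.norm D + 1 := by
    intro D H lD lH hHD hD hH
    have h1 : encSize lD = DB.norm D := hD.size_encodeFacts
    have h2 : encSize lH = DB.norm H := hH.size_encodeFacts
    have := DB.norm_mono hHD
    rw [encSize_pair]
    omega
  have hunr : ∀ {D : DB S} {lD lH : List (DBFact S)}, Enumerates lD D →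
      Unranks (fdConflict L) (levelCount (L.map FD.level)) (levelUnrank (L.map FD.level))
        (compatibleFacts L lD lH) := fun hD =>
    levelUnrank_unranks (isBoolEquiv_levels L) (hD.1.filter _)
  have hmem : ∀ {D H : DB S} {lD lH : List (DBFact S)}, H ∈ homImages Sig Q D → Enumerates lD D →
      Enumerates lH H → ∀ E, E ∈ repairsEntailing Sig' D (CQ.ofFacts H) ↔
        IsMaxIndep (fdConflict L) (compatibleFacts L lD lH).toFinset E := by
    intro D H lD lH h hD hH E
    obtain ⟨h1, h2⟩ := hH' h
    obtain ⟨-, rfl⟩ := hD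
    obtain ⟨-, rfl⟩ := hH
    exact mem_repairsEntailing_iff hL
      (fun f hf => List.mem_toFinset.1 (h1 (List.mem_toFinset.2 hf))) h2
  have hcnt : Polytime (fun y : List (DBFact S) × List (DBFact S) =>
      levelCount (L.map FD.level) (compatibleFacts L y.1 y.2)) :=
    (Polytime.levelCount (polytime_levels L)).comp (polytime_compatibleFacts L)
  refine ⟨?_, ?_, ?_⟩
  · obtain ⟨P, pol, hdet, hP⟩ := hcnt
    refine ⟨P, pol.comp (2 * Polynomial.X + 1), hdet, fun D H h lD lH hD hH => ?_⟩
    rw [(hunr (lH := lH) hD).card_eq (hmem h hD hH)]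
    refine (hP (lD, lH)).1.mono ?_
    simpa using pol.eval_mono_nat (hsize (hH' h).1 hD hH)
  · have hf : Polytime (fun y : (List (DBFact S) × List (DBFact S)) × ℕ =>
        (levelUnrank (L.map FD.level) (compatibleFacts L y.1.1 y.1.2) 1 y.2).1) :=
      ((Polytime.levelUnrank (polytime_levels L)).comp
        (((polytime_compatibleFacts L).comp Polytime.fst_aux).prodMk
          ((Polytime.const 1).prodMk Polytime.snd_aux))).fst
    obtain ⟨P, pol, hP⟩ := hf.exists_run_draw hcnt
    refine ⟨P, pol.comp (2 * Polynomial.X + 1), fun D H h => ?_⟩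
    -- The count is positive; any enumeration of D and H shows this.
    have hne : (repairsEntailing Sig' D (CQ.ofFacts H)).Nonempty := by
      have hD : Enumerates D.toList D := ⟨D.nodup_toList, D.toList_toFinset⟩
      have hH : Enumerates H.toList H := ⟨H.nodup_toList, H.toList_toFinset⟩
      rw [← Finset.card_pos, (hunr (lH := H.toList) hD).card_eq (hmem h hD hH)]
      exact (hunr hD).pos
    refine ⟨hne, fun lD lH hD hH => ?_⟩
    have hU := hunr (lH := lH) hD
    obtain ⟨n, hn⟩ := Nat.exists_eq_succ_of_ne_zero hU.pos.ne'
    refine ⟨_, ?_, hU.map_uniform (hmem h hD hH) hne hn, (hP (lD, lH) n hn).mono ?_⟩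
    · intro l hl
      obtain ⟨k, -, rfl⟩ := (PMF.mem_support_map_iff _ _ _).1 hl
      exact (hU.sound 1 k (by rw [mul_one, hn]; exact k.2)).1
    · simpa using pol.eval_mono_nat (hsize (hH' h).1 hD hH)
  · obtain ⟨P, pol, hdet, hP⟩ := polytime_isRepairTest L
    -- Three databases and two pair nodes: the same polynomial works in ‖D‖ + ‖D'‖, and in ‖D‖ alone
    -- once D' ⊆ D.
    refine ⟨P, pol.comp (3 * Polynomial.X + 2), hdet, fun D H h D' lD lH lD' hD hH hD' =>
      ⟨pol.eval (encSize ((lD, lH), lD')), ?_, ?_, fun hsub => ?_⟩⟩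
    · have h1 := (hP ((lD, lH), lD')).1
      have h2 : enc (isRepairTest L lD lH lD') =
          .num (if D' ∈ repairsEntailing Sig' D (CQ.ofFacts H) then 1 else 0) := by
        obtain ⟨-, rfl⟩ := hD
        obtain ⟨-, rfl⟩ := hH
        obtain ⟨-, rfl⟩ := hD'
        simp only [enc, isRepairTest_iff hL]
      rw [← h2]
      exact h1
    all_goals
      have h1 := hsize (hH' h).1 hD hH
      have h2 : encSize lD' = DB.norm D' := hD'.size_encodeFacts
      rw [Polynomial.eval_comp]
      refine pol.eval_mono_nat ?_
      simp only [Polynomial.eval_add, Polynomial.eval_mul, Polynomial.eval_X,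
        Polynomial.eval_ofNat]
      rw [encSize_pair]
    · omega
    · have := DB.norm_mono hsub
      omega
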